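/- Let $n\ge 0$ be an integer. There exists a separable metric space $M_n$ with $\operatorname{asdim} M_n=n$ such that every proper metric space $X$ with $\operatorname{asdim} X\le n$ admits a large scale embedding $f\colon X\to M_n$. Here a metric space is proper if its closed balls are compact. The inequality $\operatorname{asdim} X\le n$ means that for every $D>0$ there is a cover $\mathcal U=\mathcal U^0\cup\dots\cup\mathcal U^n$ of $X$ whose members have uniformly bounded diameters and in which every family $\mathcal U^i$ is $D$-disjoint (distinct members of $\mathcal U^i$ are at distance at least $D$); $\operatorname{asdim}X=n$ means that $n$ is the least non-negative integer with $\operatorname{asdim}X\le n$. A map $f\colon X\to Y$ of metric spaces is a large scale embedding if there are non-decreasing functions $\varphi_1,\varphi_2\colon[0,\infty)\to[0,\infty)$ with $\lim_{t\to\infty}\varphi_1(t)=\lim_{t\to\infty}\varphi_2(t)=\infty$ and $\varphi_1(d(x,y))\le d(f(x),f(y))\le\varphi_2(d(x,y))$ for all $x,y\in X$. -/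

import Mathlib

/-- A family `U` of subsets of a metric space is uniformly bounded if the diameters of its members
have a common finite bound. -/
def UniformlyBounded {X : Type*} [MetricSpace X] (U : Set (Set X)) : Prop :=
  ∃ C : ℝ, 0 < C ∧ ∀ A ∈ U, ∀ x ∈ A, ∀ y ∈ A, dist x y ≤ C

/-- A family `U` of subsets of a metric space is `D`-disjoint if any two distinct members are at
distance at least `D` from each other. -/
def DisjointAtScale {X : Type*} [MetricSpace X] (D : ℝ) (U : Set (Set X)) : Prop :=
  ∀ A ∈ U, ∀ B ∈ U, A ≠ B → ∀ a ∈ A, ∀ b ∈ B, D ≤ dist a b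

/-- `asdim X ≤ n`: for every `D > 0` there is a uniformly bounded cover of `X` which is the union
of `n + 1` families that are `D`-disjoint. -/
def AsdimLE (X : Type*) [MetricSpace X] (n : ℕ) : Prop :=
  ∀ D : ℝ, 0 < D → ∃ U : Fin (n + 1) → Set (Set X),
    (⋃ i, ⋃₀ U i) = Set.univ ∧ UniformlyBounded (⋃ i, U i) ∧ ∀ i, DisjointAtScale D (U i)

/-- `asdim X = n`: `n` is the least natural number with `asdim X ≤ n`. -/
def AsdimEq (X : Type*) [MetricSpace X] (n : ℕ) : Prop :=
  AsdimLE X n ∧ ∀ m < n, ¬ AsdimLE X m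

/-- Large scale (coarse) embeddings of metric spaces. -/
def IsLargeScaleEmbedding {X Y : Type*} [MetricSpace X] [MetricSpace Y] (f : X → Y) : Prop :=
  ∃ φ₁ φ₂ : NNReal → NNReal, Monotone φ₁ ∧ Monotone φ₂ ∧
    Filter.Tendsto φ₁ Filter.atTop Filter.atTop ∧ Filter.Tendsto φ₂ Filter.atTop Filter.atTop ∧
    ∀ x y : X, φ₁ (nndist x y) ≤ nndist (f x) (f y) ∧ nndist (f x) (f y) ≤ φ₂ (nndist x y)

/-- One step of length less than `s` between two points of `A`. -/
def ChainStep {X : Type*} [PseudoMetricSpace X] (s : ℝ) (A : Set X) (x y : X) : Prop :=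
  x ∈ A ∧ y ∈ A ∧ dist x y < s

/-- Points of `A` joined by a chain in `A` with steps of length less than `s` are at distance at
most `b`. -/
def ChainBounded {X : Type*} [PseudoMetricSpace X] (s b : ℝ) (A : Set X) : Prop :=
  ∀ x y, Relation.ReflTransGen (ChainStep s A) x y → dist x y ≤ b

namespace ChainBounded

variable {X Y : Type*} [PseudoMetricSpace X] [PseudoMetricSpace Y] {s t b c : ℝ} {A B : Set X}

theorem nonneg_bound [h : Nonempty X] (hA : ChainBounded s b A) : 0 ≤ b := by
  obtain ⟨x⟩ := h
  simpa using hA x x .refl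

theorem mono (hA : ChainBounded s b A) (hBA : B ⊆ A) (hts : t ≤ s) (hbc : b ≤ c) :
    ChainBounded t c B := fun x y h =>
  (hA x y (Relation.ReflTransGen.mono
    (fun _ _ h => ⟨hBA h.1, hBA h.2.1, h.2.2.trans_le hts⟩) _ _ h)).trans hbc

/-- To bound chains it suffices to bound a relation that is preserved along them. -/
theorem of_invariant (hb : 0 ≤ b) (E : X → X → Prop) (hrefl : ∀ x ∈ A, E x x)
    (hstep : ∀ x y z, x ∈ A → y ∈ A → z ∈ A → E x y → dist y z < s → E x z)
    (hE : ∀ x y, E x y → dist x y ≤ b) : ChainBounded s b A := by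
  intro x y h
  by_cases hxy : x = y
  · simpa [hxy] using hb
  · have : x = y ∨ (x ∈ A ∧ E x y) := by
      clear hxy
      induction h with
      | refl => exact .inl rfl
      | tail _ h ih =>
        rcases ih with rfl | ⟨hx, ih⟩
        · exact .inr ⟨h.1, hstep _ _ _ h.1 h.1 h.2.1 (hrefl _ h.1) h.2.2⟩
        · exact .inr ⟨hx, hstep _ _ _ hx h.1 h.2.1 ih h.2.2⟩
    exact hE _ _ (this.resolve_left hxy).2

theorem empty (hb : 0 ≤ b) : ChainBounded s b (∅ : Set X) :=
  of_invariant hb (fun _ _ => False) (by simp) (by simp) (by simp)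

/-- Pulling back along a map that does not expand distances below `t` beyond `s`. -/
theorem preimage {B : Set Y} (hB : ChainBounded s b B) (f : X → Y)
    (hf : ∀ x y, dist x y < t → dist (f x) (f y) < s)
    (hc : ∀ x y, dist (f x) (f y) ≤ b → dist x y ≤ c) : ChainBounded t c (f ⁻¹' B) := by
  intro x y h
  refine hc _ _ (hB _ _ (Relation.ReflTransGen.lift f (fun u v h => ?_) _ _ h))
  exact ⟨h.1, h.2.1, hf _ _ h.2.2⟩

theorem pi {ι : Type*} [Fintype ι] {Z : ι → Type*} [∀ i, PseudoMetricSpace (Z i)]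
    {A : Set (∀ i, Z i)} (hb : 0 ≤ b) (B : ∀ i, Set (Z i))
    (hA : ∀ x ∈ A, ∀ i, x i ∈ B i) (hB : ∀ i, ChainBounded s b (B i)) : ChainBounded s b A := by
  intro x y h
  refine (dist_pi_le_iff hb).2 fun i => hB i _ _ ?_
  refine Relation.ReflTransGen.lift (fun x => x i) (fun u v h => ?_) _ _ h
  exact ⟨hA _ h.1 i, hA _ h.2.1 i, (dist_le_pi_dist u v i).trans_lt h.2.2⟩

theorem union (hb : 0 ≤ b) (hs : 0 ≤ s) (hA : ChainBounded s b A) (hB : ChainBounded t c B)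
    (ht : b + 2 * s < t) : ChainBounded s (c + 2 * (b + s)) (A ∪ B) := by
  intro x y h
  have key : Relation.ReflTransGen (ChainStep s A) x y ∨
      ∃ p q, dist x p ≤ b + s ∧ Relation.ReflTransGen (ChainStep t B) p q ∧ q ∈ B ∧
        (q = y ∨ ∃ u, dist q u ≤ s ∧ u ∈ A ∧ Relation.ReflTransGen (ChainStep s A) u y) := by
    induction h with
    | refl => exact .inl .refl
    | @tail y z _ h ih =>
      obtain ⟨hy, hz, hyz⟩ := h
      rcases ih with ih | ⟨p, q, hp, hpq, hq, ih⟩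
      · by_cases hzB : z ∈ B
        · refine .inr ⟨z, z, ?_, .refl, hzB, .inl rfl⟩
          linarith [dist_triangle x y z, hA _ _ ih]
        · have hzA := hz.resolve_right hzB
          by_cases hyA : y ∈ A
          · exact .inl (ih.tail ⟨hyA, hzA, hyz⟩)
          · refine .inr ⟨y, y, ?_, .refl, hy.resolve_left hyA, .inr ⟨z, hyz.le, hzA, .refl⟩⟩
            linarith [hA _ _ ih]
      · refine .inr ⟨p, ?_⟩
        have hqy : dist q y ≤ b + s := by
          rcases ih with rfl | ⟨u, hu, -, ih⟩
          · simp; linarith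
          · linarith [dist_triangle q u y, hA _ _ ih]
        by_cases hzB : z ∈ B
        · refine ⟨z, hp, hpq.tail ⟨hq, hzB, ?_⟩, hzB, .inl rfl⟩
          linarith [dist_triangle q y z]
        · have hzA := hz.resolve_right hzB
          rcases ih with rfl | ⟨u, hu, huA, ih⟩
          · exact ⟨q, hp, hpq, hq, .inr ⟨z, hyz.le, hzA, .refl⟩⟩
          · by_cases hyA : y ∈ A
            · exact ⟨q, hp, hpq, hq, .inr ⟨u, hu, huA, ih.tail ⟨hyA, hzA, hyz⟩⟩⟩
            · have hyB := hy.resolve_left hyA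
              refine ⟨y, hp, hpq.tail ⟨hq, hyB, ?_⟩, hyB, .inr ⟨z, hyz.le, hzA, .refl⟩⟩
              linarith
  have : Nonempty X := ⟨x⟩
  have hc := hB.nonneg_bound
  rcases key with h | ⟨p, q, hp, hpq, -, h⟩
  · linarith [hA _ _ h]
  · have hqy : dist q y ≤ b + s := by
      rcases h with rfl | ⟨u, hu, -, ih⟩
      · simp; linarith
      · linarith [dist_triangle q u y, hA _ _ ih]
    linarith [dist_triangle x p y, dist_triangle p q y, hB _ _ hpq]

/-- Chains in a neighbourhood of `A` are shadowed by chains in `A`. -/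
theorem thicken (hs : 0 < s) (hA : ChainBounded (3 * s) b A) :
    ChainBounded s (b + 2 * s) {x | ∃ a ∈ A, dist x a < s} := by
  by_cases hX : Nonempty X
  swap
  · intro x; exact (hX ⟨x⟩).elim
  have hb := hA.nonneg_bound
  refine of_invariant (by linarith)
    (fun x y => ∃ p q, dist x p < s ∧ dist y q < s ∧ p ∈ A ∧ q ∈ A ∧
      Relation.ReflTransGen (ChainStep (3 * s) A) p q) ?_ ?_ ?_
  · rintro x ⟨a, ha, hxa⟩
    exact ⟨a, a, hxa, hxa, ha, ha, .refl⟩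
  · rintro x y z - - ⟨r, hr, hzr⟩ ⟨p, q, hp, hq, hpA, hqA, h⟩ hyz
    refine ⟨p, r, hp, hzr, hpA, hr, h.tail ⟨hqA, hr, ?_⟩⟩
    linarith [dist_triangle q y r, dist_triangle y z r, dist_comm q y]
  · rintro x y ⟨p, q, hp, hq, -, -, h⟩
    linarith [dist_triangle x p y, dist_triangle p q y, hA _ _ h, dist_comm q y]

end ChainBounded

/-- A family of sets such that every point misses at most one of them. -/
def MissesAtMostOne {X ι : Type*} (A : ι → Set X) : Prop :=
  ∀ x, ∀ i j, i ≠ j → x ∈ A i ∨ x ∈ A j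

/-- Kolmogorov's trick: one more colour at the price of a smaller scale. -/
theorem MissesAtMostOne.succ {X : Type*} [PseudoMetricSpace X] {s b : ℝ} (hs : 0 < s) {m : ℕ}
    (A : Fin (m + 2) → Set X) (hA : MissesAtMostOne A) (hc : ∀ i, ChainBounded (3 * s) b (A i)) :
    ∃ A' : Fin (m + 3) → Set X, MissesAtMostOne A' ∧ ∀ i, ChainBounded s (b + 2 * s) (A' i) := by
  have hsub : ∀ i x, x ∈ A i → ∃ a ∈ A i, dist x a < s := fun i x hx => ⟨x, hx, by simpa using hs⟩
  refine ⟨Fin.cons {x | ∃ j, ¬ ∃ a ∈ A j, dist x a < s}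
    (fun j => {x | ∃ a ∈ A j, dist x a < s}), ?_, ?_⟩
  · intro x i j hij
    induction i using Fin.cases with
    | zero =>
      induction j using Fin.cases with
      | zero => exact (hij rfl).elim
      | succ j =>
        simp only [Fin.cons_zero, Fin.cons_succ, Set.mem_ofPred_eq]
        by_cases h : ∃ a ∈ A j, dist x a < s
        · exact .inr h
        · exact .inl ⟨j, h⟩
    | succ i =>
      induction j using Fin.cases with
      | zero =>
        simp only [Fin.cons_zero, Fin.cons_succ, Set.mem_ofPred_eq]
        by_cases h : ∃ a ∈ A i, dist x a < s
        · exact .inl h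
        · exact .inr ⟨i, h⟩
      | succ j =>
        simp only [Fin.cons_succ, Set.mem_ofPred_eq]
        exact (hA x i j (by simpa using hij)).imp (hsub _ _) (hsub _ _)
  · intro i
    induction i using Fin.cases with
    | succ i => exact (hc i).thicken hs
    | zero =>
      by_cases hX : Nonempty X
      swap
      · intro x; exact (hX ⟨x⟩).elim
      have hb := (hc 0).nonneg_bound
      simp only [Fin.cons_zero]
      have hmem : ∀ (j k : Fin (m + 2)) (x : X), j ≠ k → (¬ ∃ a ∈ A j, dist x a < s) → x ∈ A k :=
        fun j k x hjk hx => (hA x j k hjk).resolve_left fun h => hx (hsub _ _ h)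
      refine ChainBounded.of_invariant (by linarith)
        (fun x y => ∃ j k, j ≠ k ∧ (¬ ∃ a ∈ A j, dist y a < s) ∧
          Relation.ReflTransGen (ChainStep (3 * s) (A k)) x y) ?_ ?_ ?_
      · rintro x ⟨j, hj⟩
        obtain ⟨k, hk⟩ := exists_ne j
        exact ⟨j, k, hk.symm, hj, .refl⟩
      · rintro x y z - - ⟨j', hj'⟩ ⟨j, k, hjk, hj, h⟩ hyz
        have : j' = j := by
          by_contra hne
          exact hj' ⟨y, hmem j j' y (Ne.symm hne) hj, by rwa [dist_comm]⟩
        subst this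
        exact ⟨j', k, hjk, hj', h.tail ⟨hmem _ _ _ hjk hj, hmem _ _ _ hjk hj', by linarith⟩⟩
      · rintro x y ⟨j, k, -, -, h⟩
        linarith [hc k _ _ h]

/-- If a space can be split into two sets with linearly bounded chains at every scale, then it has
`m` such sets with every point missing at most one. -/
theorem exists_missesAtMostOne {X : Type*} [PseudoMetricSpace X]
    (h : ∀ s : ℕ, 0 < s → ∃ A : Fin 2 → Set X, MissesAtMostOne A ∧
      ∀ i, ChainBounded (s : ℝ) (2 * s) (A i)) (m s : ℕ) (hs : 0 < s) :
    ∃ A : Fin (m + 1) → Set X, MissesAtMostOne A ∧ ∀ i, ChainBounded (s : ℝ) (3 ^ m * s) (A i) := by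
  cases m with
  | zero =>
    refine ⟨fun _ => ∅, fun x i j hij => (hij (by omega)).elim, fun i =>
      ChainBounded.empty (by positivity)⟩
  | succ m =>
    have : ∃ A : Fin (m + 2) → Set X, MissesAtMostOne A ∧
        ∀ i, ChainBounded (s : ℝ) ((3 ^ (m + 1) - 1) * s) (A i) := by
      induction m generalizing s with
      | zero => simpa [show (3 : ℝ) - 1 = 2 by norm_num] using h s hs
      | succ m ih =>
        obtain ⟨A, hA, hc⟩ := ih (3 * s) (by positivity)
        obtain ⟨A', hA', hc'⟩ := MissesAtMostOne.succ (s := s) (by exact_mod_cast hs) A hA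
          (fun i => (hc i).mono subset_rfl (by push_cast; rfl) le_rfl)
        refine ⟨A', hA', fun i => (hc' i).mono subset_rfl le_rfl (le_of_eq ?_)⟩
        push_cast
        ring
    obtain ⟨A, hA, hc⟩ := this
    refine ⟨A, hA, fun i => (hc i).mono subset_rfl le_rfl ?_⟩
    have : (0 : ℝ) ≤ s := by positivity
    nlinarith

/-- Fewer coordinates than colours: some colour is good for all coordinates. -/
theorem exists_common_color {ι κ : Type*} [Fintype ι] [Fintype κ] {X : ι → Type*}
    (A : ∀ i, κ → Set (X i)) (hA : ∀ i, MissesAtMostOne (A i)) (x : ∀ i, X i) (p : ι → Prop)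
    [DecidablePred p]
    (hp : Fintype.card {i // p i} < Fintype.card κ) : ∃ j, ∀ i, p i → x i ∈ A i j := by
  classical
  by_contra! hcon
  choose g hg hgx using hcon
  have hinj : Function.Injective (fun j => (⟨g j, hg j⟩ : {i // p i})) := by
    intro j k hjk
    by_contra hne
    have h : g j = g k := congrArg Subtype.val hjk
    rcases hA (g j) (x (g j)) j k hne with h1 | h1
    · exact hgx j h1
    · rw [h] at h1; exact hgx k h1
  exact absurd (Fintype.card_le_of_injective _ hinj) (not_le.2 hp)

theorem asdimLE_iff_chainBounded {X : Type*} [MetricSpace X] {n : ℕ} :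
    AsdimLE X n ↔ ∀ s : ℝ, 0 < s → ∃ b, ∃ A : Fin (n + 1) → Set X,
      (∀ x, ∃ i, x ∈ A i) ∧ ∀ i, ChainBounded s b (A i) := by
  constructor
  · intro h s hs
    obtain ⟨U, hU, ⟨C, hC, hb⟩, hd⟩ := h s hs
    refine ⟨C, fun i => ⋃₀ U i, fun x => by
      simpa using (hU ▸ Set.mem_univ x : x ∈ ⋃ i, ⋃₀ U i), fun i => ?_⟩
    refine ChainBounded.of_invariant hC.le (fun x y => ∃ V ∈ U i, x ∈ V ∧ y ∈ V) ?_ ?_ ?_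
    · rintro x ⟨V, hV, hx⟩
      exact ⟨V, hV, hx, hx⟩
    · rintro x y z - - ⟨W, hW, hz⟩ ⟨V, hV, hx, hy⟩ hyz
      have : V = W := by
        by_contra hne
        exact absurd (hd i V hV W hW hne y hy z hz) (not_le.2 hyz)
      exact ⟨V, hV, hx, this ▸ hz⟩
    · rintro x y ⟨V, hV, hx, hy⟩
      exact hb V (Set.mem_iUnion.2 ⟨i, hV⟩) x hx y hy
  · intro h D hD
    obtain ⟨b, A, hcov, hA⟩ := h D hD
    have hsymm : ∀ i x y, Relation.ReflTransGen (ChainStep D (A i)) x y →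
        Relation.ReflTransGen (ChainStep D (A i)) y x := fun i x y h =>
      haveI : Std.Symm (ChainStep D (A i)) :=
        ⟨fun u v h => ⟨h.2.1, h.1, by rw [dist_comm]; exact h.2.2⟩⟩
      Relation.ReflTransGen.stdSymm.symm _ _ h
    refine ⟨fun i => {V | ∃ x ∈ A i, V = {y | y ∈ A i ∧
      Relation.ReflTransGen (ChainStep D (A i)) x y}}, ?_, ?_, ?_⟩
    · refine Set.eq_univ_of_forall fun x => ?_
      obtain ⟨i, hi⟩ := hcov x
      exact Set.mem_iUnion.2 ⟨i, _, ⟨x, hi, rfl⟩, hi, .refl⟩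
    · refine ⟨max b 1, by positivity, ?_⟩
      rintro V hV y hy z hz
      obtain ⟨i, x, hx, rfl⟩ := Set.mem_iUnion.1 hV
      exact (hA i _ _ ((hsymm _ _ _ hy.2).trans hz.2)).trans (le_max_left _ _)
    · rintro i _ ⟨x, hx, rfl⟩ _ ⟨y, hy, rfl⟩ hne a ⟨ha, hxa⟩ c ⟨hc, hyc⟩
      by_contra! hlt
      have hxy := (hxa.tail ⟨ha, hc, hlt⟩).trans (hsymm _ _ _ hyc)
      refine hne (Set.ext fun z => and_congr_right fun _ => ⟨fun h => ?_, fun h => ?_⟩)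
      · exact (hsymm _ _ _ hxy).trans h
      · exact hxy.trans h

theorem AsdimLE.of_isLargeScaleEmbedding {X Y : Type*} [MetricSpace X] [MetricSpace Y] {n : ℕ}
    {f : X → Y} (hf : IsLargeScaleEmbedding f) (hY : AsdimLE Y n) : AsdimLE X n := by
  obtain ⟨φ₁, φ₂, h₁, h₂, hφ₁, -, h⟩ := hf
  rw [asdimLE_iff_chainBounded] at hY ⊢
  intro s hs
  obtain ⟨b, A, hcov, hA⟩ := hY (φ₂ s.toNNReal + 1) (by positivity)
  obtain ⟨R, hR⟩ := Filter.eventually_atTop.1 (hφ₁.eventually_gt_atTop b.toNNReal)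
  refine ⟨R, fun i => f ⁻¹' A i, fun x => hcov (f x), fun i => (hA i).preimage f ?_ ?_⟩
  · intro x y hxy
    have := (h x y).2.trans (h₂ (show nndist x y ≤ s.toNNReal by
      rw [← NNReal.coe_le_coe, coe_nndist, Real.coe_toNNReal _ hs.le]; exact hxy.le))
    rw [← NNReal.coe_le_coe, coe_nndist] at this
    linarith
  · intro x y hxy
    by_contra! hlt
    have h1 := hR (nndist x y) (by rw [← NNReal.coe_le_coe, coe_nndist]; exact hlt.le)
    have h2 := h1.trans_le (h x y).1
    rw [Real.toNNReal_lt_iff_lt_coe (dist_nonneg.trans hxy), coe_nndist] at h2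
    linarith

/-- A criterion for large scale embeddings with an affine upper bound. -/
theorem isLargeScaleEmbedding_of_forall {X Y : Type*} [MetricSpace X] [MetricSpace Y] {f : X → Y}
    (a : NNReal) (hup : ∀ x y, dist (f x) (f y) ≤ 2 * dist x y + a)
    (hlow : ∀ k : ℕ, ∃ R : ℝ, ∀ x y, dist (f x) (f y) ≤ k → dist x y ≤ R) :
    IsLargeScaleEmbedding f := by
  choose R hR using hlow
  have hbdd : ∀ t : NNReal, BddAbove {k : ℕ | (k : NNReal) ≤ t ∧ R k < t} := fun t =>
    ⟨⌊t⌋₊, fun k hk => Nat.le_floor hk.1⟩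
  have hmono : Monotone fun t : NNReal => sSup {k : ℕ | (k : NNReal) ≤ t ∧ R k < t} := by
    intro t u htu
    by_cases hne : {k : ℕ | (k : NNReal) ≤ t ∧ R k < t}.Nonempty
    · exact csSup_le_csSup (hbdd u) hne fun k hk =>
        ⟨hk.1.trans htu, hk.2.trans_le (by exact_mod_cast htu)⟩
    · simp [Set.not_nonempty_iff_eq_empty.1 hne]
  refine ⟨fun t => (sSup {k : ℕ | (k : NNReal) ≤ t ∧ R k < t} : ℕ), fun t => 2 * t + a,
    fun t u htu => by simpa using hmono htu, fun t u htu => by dsimp; gcongr, ?_, ?_, ?_⟩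
  · refine tendsto_natCast_atTop_atTop.comp (Filter.tendsto_atTop.2 fun k => ?_)
    filter_upwards [Filter.eventually_ge_atTop (max (k : NNReal) (R k + 1).toNNReal)] with t ht
    refine le_csSup (hbdd t) ⟨(le_max_left _ _).trans ht, ?_⟩
    have := (Real.le_coe_toNNReal (R k + 1)).trans
      (NNReal.coe_le_coe.2 ((le_max_right _ _).trans ht))
    linarith
  · refine Filter.tendsto_atTop_mono (fun t => ?_) Filter.tendsto_id
    rw [id, two_mul, add_assoc]
    exact le_self_add
  · intro x y
    refine ⟨?_, ?_⟩
    · by_cases hne : {k : ℕ | (k : NNReal) ≤ nndist x y ∧ R k < nndist x y}.Nonempty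
      · have hmem := Nat.sSup_mem hne (hbdd _)
        by_contra! hlt
        have := hR _ x y (by rw [← coe_nndist]; exact_mod_cast hlt.le)
        exact absurd this (not_le.2 hmem.2)
      · dsimp only
        rw [Set.not_nonempty_iff_eq_empty.1 hne]
        simp
    · rw [← NNReal.coe_le_coe]
      push_cast
      exact hup x y

/-- A countable tree-like space. A point is a sequence of pairs (deficiency, label), eventually
zero; at level `k` it lies on the spine of length `D k` given by its label at level `k` and by all
its later entries, at height `D k` minus the deficiency. -/
def SpineTree (_D : ℕ → ℕ) : Type := ℕ →₀ ℕ × ℕ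

namespace SpineTree

variable {D : ℕ → ℕ}

instance : FunLike (SpineTree D) ℕ (ℕ × ℕ) := inferInstanceAs (FunLike (ℕ →₀ ℕ × ℕ) ℕ (ℕ × ℕ))

instance : Countable (SpineTree D) := inferInstanceAs (Countable (ℕ →₀ ℕ × ℕ))

theorem exists_forall_eq_zero (a : SpineTree D) : ∃ N, ∀ k, N ≤ k → a k = 0 := by
  obtain ⟨N, hN⟩ := (Finsupp.support (α := ℕ) (M := ℕ × ℕ) a).exists_nat_subset_range
  refine ⟨N, fun k hk => ?_⟩
  by_contra h
  exact absurd (Finset.mem_range.1 (hN (Finsupp.mem_support_iff.2 h))) (not_lt.2 hk)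

theorem exists_forall_eq (a b : SpineTree D) : ∃ N, ∀ k, N ≤ k → a k = b k := by
  obtain ⟨N, hN⟩ := a.exists_forall_eq_zero
  obtain ⟨K, hK⟩ := b.exists_forall_eq_zero
  exact ⟨max N K, fun k hk => by
    rw [hN k (le_of_max_le_left hk), hK k (le_of_max_le_right hk)]⟩

/-- The height of a point on its spine of level `k`. -/
def height (a : SpineTree D) (k : ℕ) : ℕ := D k - (a k).1

theorem height_le (a : SpineTree D) (k : ℕ) : a.height k ≤ D k := Nat.sub_le _ _

/-- Two points lie on a common spine of level `k`, at positive heights. -/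
def SameSpine (a b : SpineTree D) (k : ℕ) : Prop :=
  0 < a.height k ∧ 0 < b.height k ∧ (a k).2 = (b k).2 ∧ ∀ j, k < j → a j = b j

theorem SameSpine.symm {a b : SpineTree D} {k : ℕ} (h : SameSpine a b k) : SameSpine b a k :=
  ⟨h.2.1, h.1, h.2.2.1.symm, fun j hj => (h.2.2.2 j hj).symm⟩

theorem SameSpine.trans {a b c : SpineTree D} {k : ℕ} (h : SameSpine a b k)
    (h' : SameSpine b c k) : SameSpine a c k :=
  ⟨h.1, h'.2.1, h.2.2.1.trans h'.2.2.1, fun j hj => (h.2.2.2 j hj).trans (h'.2.2.2 j hj)⟩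

theorem sameSpine_self {a : SpineTree D} {k : ℕ} (h : 0 < a.height k) : SameSpine a a k :=
  ⟨h, h, rfl, fun _ _ => rfl⟩

open Classical in
/-- The hedgehog distance at level `k`. -/
noncomputable def levelDist (a b : SpineTree D) (k : ℕ) : ℕ :=
  if SameSpine a b k then Nat.dist (a.height k) (b.height k) else a.height k + b.height k

theorem levelDist_of_sameSpine {a b : SpineTree D} {k : ℕ} (h : SameSpine a b k) :
    levelDist a b k = Nat.dist (a.height k) (b.height k) := if_pos h

theorem levelDist_of_not_sameSpine {a b : SpineTree D} {k : ℕ} (h : ¬ SameSpine a b k) :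
    levelDist a b k = a.height k + b.height k := if_neg h

theorem levelDist_le_add (a b : SpineTree D) (k : ℕ) :
    levelDist a b k ≤ a.height k + b.height k := by
  by_cases h : SameSpine a b k
  · rw [levelDist_of_sameSpine h, Nat.dist]; omega
  · rw [levelDist_of_not_sameSpine h]

theorem levelDist_comm (a b : SpineTree D) (k : ℕ) : levelDist a b k = levelDist b a k := by
  by_cases h : SameSpine a b k
  · rw [levelDist_of_sameSpine h, levelDist_of_sameSpine h.symm, Nat.dist_comm]
  · rw [levelDist_of_not_sameSpine h, levelDist_of_not_sameSpine (fun h' => h h'.symm), add_comm]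

theorem levelDist_triangle (a b c : SpineTree D) (k : ℕ) :
    levelDist a c k ≤ levelDist a b k + levelDist b c k := by
  by_cases hab : SameSpine a b k
  · by_cases hbc : SameSpine b c k
    · rw [levelDist_of_sameSpine hab, levelDist_of_sameSpine hbc,
        levelDist_of_sameSpine (hab.trans hbc)]
      simp only [Nat.dist]; omega
    · rw [levelDist_of_sameSpine hab, levelDist_of_not_sameSpine hbc]
      refine (levelDist_le_add a c k).trans ?_
      simp only [Nat.dist]; omega
  · rw [levelDist_of_not_sameSpine hab]
    by_cases hbc : SameSpine b c k
    · rw [levelDist_of_sameSpine hbc]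
      refine (levelDist_le_add a c k).trans ?_
      simp only [Nat.dist]; omega
    · rw [levelDist_of_not_sameSpine hbc]
      refine (levelDist_le_add a c k).trans ?_
      omega

theorem levelDist_eq_zero {a b : SpineTree D} {k : ℕ} (h : ∀ j, k ≤ j → a j = b j) :
    levelDist a b k = 0 := by
  have hh : a.height k = b.height k := by simp [height, h k le_rfl]
  by_cases h0 : 0 < a.height k
  · rw [levelDist_of_sameSpine ⟨h0, hh ▸ h0, by rw [h k le_rfl], fun j hj => h j hj.le⟩, hh,
      Nat.dist_self]
  · have := levelDist_le_add a b k
    omega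

theorem bddAbove_levelDist (a b : SpineTree D) : BddAbove (Set.range (levelDist a b)) := by
  obtain ⟨N, hN⟩ := exists_forall_eq a b
  refine ⟨∑ k ∈ Finset.range N, levelDist a b k, ?_⟩
  rintro _ ⟨k, rfl⟩
  rcases lt_or_ge k N with hk | hk
  · exact Finset.single_le_sum (f := levelDist a b) (fun _ _ => Nat.zero_le _)
      (Finset.mem_range.2 hk)
  · rw [levelDist_eq_zero fun j hj => hN j (hk.trans hj)]
    exact Nat.zero_le _

open Classical in
/-- The distance in a spine tree, as a natural number. -/
noncomputable def natDist (a b : SpineTree D) : ℕ :=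
  (⨆ k, levelDist a b k) ⊔ if a = b then 0 else 1

theorem natDist_le_iff {a b : SpineTree D} {C : ℕ} :
    natDist a b ≤ C ↔ (a ≠ b → 1 ≤ C) ∧ ∀ k, levelDist a b k ≤ C := by
  rw [natDist, sup_le_iff, ciSup_le_iff (bddAbove_levelDist a b), and_comm]
  refine and_congr_left fun _ => ?_
  by_cases h : a = b <;> simp [h]

theorem levelDist_le_natDist (a b : SpineTree D) (k : ℕ) : levelDist a b k ≤ natDist a b :=
  (natDist_le_iff.1 le_rfl).2 k

noncomputable instance : MetricSpace (SpineTree D) where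
  dist a b := natDist a b
  dist_self a := by
    have : natDist a a ≤ 0 := natDist_le_iff.2
      ⟨fun h => (h rfl).elim, fun k => (levelDist_eq_zero fun _ _ => rfl).le⟩
    exact_mod_cast Nat.le_zero.1 this
  dist_comm a b := by
    have h : ∀ a b : SpineTree D, natDist a b ≤ natDist b a := fun a b => natDist_le_iff.2
      ⟨fun h => (natDist_le_iff.1 le_rfl).1 h.symm,
        fun k => levelDist_comm a b k ▸ levelDist_le_natDist b a k⟩
    exact_mod_cast (h a b).antisymm (h b a)
  dist_triangle a b c := by
    have : natDist a c ≤ natDist a b + natDist b c := by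
      refine natDist_le_iff.2 ⟨fun h => ?_, fun k => (levelDist_triangle a b c k).trans
        (add_le_add (levelDist_le_natDist _ _ _) (levelDist_le_natDist _ _ _))⟩
      by_cases hab : a = b
      · subst hab
        exact ((natDist_le_iff.1 le_rfl).1 h).trans (Nat.le_add_left _ _)
      · exact ((natDist_le_iff.1 le_rfl).1 hab).trans (Nat.le_add_right _ _)
    exact_mod_cast this
  eq_of_dist_eq_zero {a b} h := by
    by_contra hne
    have h1 := (natDist_le_iff.1 (le_refl (natDist a b))).1 hne
    have h2 : natDist a b = 0 := by exact_mod_cast h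
    omega

theorem dist_def (a b : SpineTree D) : dist a b = natDist a b := rfl

theorem levelDist_le_dist (a b : SpineTree D) (k : ℕ) : (levelDist a b k : ℝ) ≤ dist a b := by
  rw [dist_def]
  exact_mod_cast levelDist_le_natDist a b k

theorem dist_le_natCast {a b : SpineTree D} {C : ℕ} (hC : 1 ≤ C) (h : ∀ k, levelDist a b k ≤ C) :
    dist a b ≤ C := by
  rw [dist_def]
  exact_mod_cast natDist_le_iff.2 ⟨fun _ => hC, h⟩

/-- The two points lie in the same piece of the subdivision of the spines into segments of
length `s`. -/
def SamePiece (s : ℕ) (a b : SpineTree D) : Prop :=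
  ∀ k, a.height k / s = b.height k / s ∧ (0 < a.height k / s → SameSpine a b k)

theorem SamePiece.dist_le {s : ℕ} (hs : 0 < s) {a b : SpineTree D} (h : SamePiece s a b) :
    dist a b ≤ 2 * s := by
  have : dist a b ≤ (2 * s : ℕ) := by
    refine dist_le_natCast (by omega) fun k => ?_
    obtain ⟨h1, h2⟩ := h k
    have ha := Nat.div_add_mod (a.height k) s
    have hb := Nat.div_add_mod (b.height k) s
    have ha' := Nat.mod_lt (a.height k) hs
    have hb' := Nat.mod_lt (b.height k) hs
    by_cases h0 : 0 < a.height k / s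
    · rw [levelDist_of_sameSpine (h2 h0), Nat.dist]
      rw [h1] at ha
      omega
    · have h0' : a.height k / s = 0 := Nat.eq_zero_of_not_pos h0
      refine (levelDist_le_add a b k).trans ?_
      rw [h0'] at ha h1
      rw [← h1, mul_zero] at hb
      rw [mul_zero] at ha
      omega
  exact_mod_cast this

theorem SamePiece.trans {s : ℕ} {a b c : SpineTree D} (h : SamePiece s a b)
    (h' : SamePiece s b c) : SamePiece s a c := fun k =>
  ⟨(h k).1.trans (h' k).1, fun h0 => ((h k).2 h0).trans ((h' k).2 ((h k).1 ▸ h0))⟩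

theorem samePiece_self {s : ℕ} (a : SpineTree D) : SamePiece s a a := fun k =>
  ⟨rfl, fun h => sameSpine_self (Nat.pos_of_ne_zero fun h0 => by simp [h0] at h)⟩

/-- The parity of the total number of pieces between the point and the end of the tree. -/
def pieceParity (s : ℕ) (a : SpineTree D) : ZMod 2 :=
  ∑ k ∈ Finsupp.support (α := ℕ) (M := ℕ × ℕ) a, ((D k / s - a.height k / s : ℕ) : ZMod 2)

theorem pieceParity_eq_sum_range (s : ℕ) (a : SpineTree D) {N : ℕ} (hN : ∀ k, N ≤ k → a k = 0) :
    a.pieceParity s = ∑ k ∈ Finset.range N, ((D k / s - a.height k / s : ℕ) : ZMod 2) := by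
  refine Finset.sum_subset (fun k hk => ?_) (fun k _ hk => ?_)
  · by_contra h
    exact Finsupp.mem_support_iff.1 hk (hN k (not_lt.1 fun h' => h (Finset.mem_range.2 h')))
  · have : a k = 0 := Finsupp.notMem_support_iff.1 hk
    simp [height, this]

theorem samePiece_of_dist_lt {s : ℕ} {a b : SpineTree D} (hab : dist a b < s)
    (hp : a.pieceParity s = b.pieceParity s) : SamePiece s a b := by
  by_contra hcon
  simp only [SamePiece, not_forall] at hcon
  obtain ⟨K, hK⟩ := hcon
  have hlt : ∀ k, levelDist a b k < s := fun k => by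
    exact_mod_cast (levelDist_le_dist a b k).trans_lt hab
  have hs : 0 < s := (Nat.zero_le _).trans_lt (hlt 0)
  have hnot : ∀ k, ¬ SameSpine a b k → a.height k / s = 0 ∧ b.height k / s = 0 := by
    intro k hk
    have := hlt k
    rw [levelDist_of_not_sameSpine hk] at this
    exact ⟨Nat.div_eq_of_lt (by omega), Nat.div_eq_of_lt (by omega)⟩
  have hspine : SameSpine a b K := by
    by_contra h
    obtain ⟨h1, h2⟩ := hnot K h
    exact hK ⟨h1.trans h2.symm, fun h0 => by omega⟩
  have hne : a.height K / s ≠ b.height K / s := fun h => hK ⟨h, fun _ => hspine⟩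
  obtain ⟨N₁, hN₁⟩ := a.exists_forall_eq_zero
  obtain ⟨N₂, hN₂⟩ := b.exists_forall_eq_zero
  set N := max (max N₁ N₂) (K + 1) with hN
  rw [a.pieceParity_eq_sum_range s (N := N) (fun k hk => hN₁ k (by omega)),
    b.pieceParity_eq_sum_range s (N := N) (fun k hk => hN₂ k (by omega))] at hp
  have hKN : K ∈ Finset.range N := Finset.mem_range.2 (by omega)
  rw [← Finset.add_sum_erase _ _ hKN, ← Finset.add_sum_erase _ _ hKN] at hp
  have hrest : ∑ k ∈ (Finset.range N).erase K, ((D k / s - a.height k / s : ℕ) : ZMod 2) =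
      ∑ k ∈ (Finset.range N).erase K, ((D k / s - b.height k / s : ℕ) : ZMod 2) := by
    refine Finset.sum_congr rfl fun k hk => ?_
    rcases lt_or_gt_of_ne (Finset.ne_of_mem_erase hk) with h | h
    · obtain ⟨h1, h2⟩ := hnot k fun h' => hne (by simp [height, h'.2.2.2 K h])
      rw [h1, h2]
    · simp [height, hspine.2.2.2 k h]
  rw [hrest, add_left_inj] at hp
  have hd := hlt K
  rw [levelDist_of_sameSpine hspine, Nat.dist] at hd
  have ha := Nat.div_le_div_right (c := s) (a.height_le K)
  have hb := Nat.div_le_div_right (c := s) (b.height_le K)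
  have h1 : a.height K / s ≤ b.height K / s + 1 := by
    rw [← Nat.add_div_right _ hs]; exact Nat.div_le_div_right (by omega)
  have h2 : b.height K / s ≤ a.height K / s + 1 := by
    rw [← Nat.add_div_right _ hs]; exact Nat.div_le_div_right (by omega)
  rw [ZMod.natCast_eq_natCast_iff'] at hp
  omega

theorem exists_missesAtMostOne_fin_two (s : ℕ) (hs : 0 < s) :
    ∃ A : Fin 2 → Set (SpineTree D), MissesAtMostOne A ∧
      ∀ i, ChainBounded (s : ℝ) (2 * s) (A i) := by
  refine ⟨fun i => {a | a.pieceParity s = (i.val : ZMod 2)}, fun a i j hij => ?_, fun i => ?_⟩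
  · simp only [Set.mem_ofPred_eq]
    generalize a.pieceParity s = p
    revert i j p
    decide
  · exact ChainBounded.of_invariant (by positivity) (SamePiece s) (fun a _ => samePiece_self a)
      (fun a b c _ hb hc h hbc => h.trans (samePiece_of_dist_lt hbc (Eq.trans hb (Eq.symm hc))))
      (fun a b h => h.dist_le hs)

theorem exists_missesAtMostOne (m s : ℕ) (hs : 0 < s) :
    ∃ A : Fin (m + 1) → Set (SpineTree D), MissesAtMostOne A ∧
      ∀ i, ChainBounded (s : ℝ) (3 ^ m * s) (A i) :=
  _root_.exists_missesAtMostOne exists_missesAtMostOne_fin_two m s hs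

/-- The points at the tips of the spines of level `k` form cells of bounded diameter. -/
theorem chainBounded_tips (hD : Monotone D) (k : ℕ) (hk : 0 < D k) :
    ChainBounded (D k : ℝ) (2 * D k) {a : SpineTree D | (a k).1 = 0} := by
  have htip : ∀ a : SpineTree D, (a k).1 = 0 → a.height k = D k := fun a h => by simp [height, h]
  refine ChainBounded.of_invariant (by positivity)
    (fun a b => SameSpine a b k ∧ a.height k = b.height k) ?_ ?_ ?_
  · intro a ha
    exact ⟨sameSpine_self ((htip a ha).symm ▸ hk), rfl⟩
  · intro a b c ha hb hc hab hbc
    refine ⟨hab.1.trans ?_, (htip a ha).trans (htip c hc).symm⟩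
    by_contra h
    have h1 : levelDist b c k < D k := by exact_mod_cast (levelDist_le_dist b c k).trans_lt hbc
    rw [levelDist_of_not_sameSpine h, htip b hb, htip c hc] at h1
    omega
  · rintro a b ⟨hab, hh⟩
    have : dist a b ≤ (2 * D k : ℕ) := by
      refine dist_le_natCast (by omega) fun j => ?_
      rcases lt_trichotomy j k with hj | rfl | hj
      · have := hD hj.le
        have := a.height_le j
        have := b.height_le j
        have := levelDist_le_add a b j
        omega
      · rw [levelDist_of_sameSpine hab, hh, Nat.dist_self]
        exact Nat.zero_le _
      · rw [levelDist_eq_zero fun i hi => hab.2.2.2 i (hj.trans_le hi)]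
        exact Nat.zero_le _
    exact_mod_cast this

end SpineTree

/-- The lengths of the spines of colour `i` at level `k`. -/
def spineLength (n i k : ℕ) : ℕ := (2 * 3 ^ n + 5) ^ ((n + 1) * k + i)

theorem spineLength_pos (n i k : ℕ) : 0 < spineLength n i k := by
  unfold spineLength; positivity

theorem spineLength_mono (n i : ℕ) : Monotone (spineLength n i) := fun k l hkl =>
  Nat.pow_le_pow_right (by positivity) (by gcongr)

theorem spineLength_succ (n i k : ℕ) :
    spineLength n (i + 1) k = (2 * 3 ^ n + 5) * spineLength n i k := by
  rw [spineLength, ← add_assoc, pow_succ']; rfl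

theorem lt_spineLength (n i k : ℕ) : k < spineLength n i k := by
  have h : 1 < 2 * 3 ^ n + 5 := by omega
  exact (Nat.lt_pow_self h).trans_le (Nat.pow_le_pow_right (by positivity) (by nlinarith))

/-- The universal space for asymptotic dimension at most `n`. -/
def UniversalSpace (n : ℕ) : Type :=
  {x : ∀ i : Fin (n + 1), SpineTree (spineLength n i) // ∀ k, ∃ i, (x i k).1 = 0}

namespace UniversalSpace

variable {n : ℕ}

noncomputable instance : MetricSpace (UniversalSpace n) := inferInstanceAs (MetricSpace (Subtype _))

instance : Countable (UniversalSpace n) := inferInstanceAs (Countable (Subtype _))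

theorem dist_le_iff {x y : UniversalSpace n} {C : ℝ} (hC : 0 ≤ C) :
    dist x y ≤ C ↔ ∀ i, dist (x.1 i) (y.1 i) ≤ C := by
  rw [show dist x y = dist x.1 y.1 from rfl, dist_pi_le_iff hC]

theorem asdimLE (n : ℕ) : AsdimLE (UniversalSpace n) n := by
  rw [asdimLE_iff_chainBounded]
  intro s hs
  obtain ⟨k, hk⟩ := exists_nat_gt s
  have hfam : ∀ i i' : Fin (n + 1), ∃ A : Fin (n + 1) → Set (SpineTree (spineLength n i')),
      MissesAtMostOne A ∧ ∀ j, ChainBounded (spineLength n i k : ℝ)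
        (3 ^ n * spineLength n i k) (A j) := fun i i' =>
    SpineTree.exists_missesAtMostOne n _ (spineLength_pos _ _ _)
  choose A hA hAb using hfam
  let B : Fin (n + 1) → Fin (n + 1) → Set (UniversalSpace n) := fun i j =>
    {x | (x.1 i k).1 = 0 ∧ ∀ i', i' ≠ i → x.1 i' ∈ A i i' j}
  have hcov : ∀ x, ∃ i j, x ∈ B i j := by
    intro x
    obtain ⟨i, hi⟩ := x.2 k
    obtain ⟨j, hj⟩ := exists_common_color (A i) (hA i) x.1 (fun i' => i' ≠ i) (by simp)
    exact ⟨i, j, hi, hj⟩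
  have hB : ∀ i j : Fin (n + 1), ChainBounded (spineLength n i k : ℝ)
      (2 * 3 ^ n * spineLength n i k) (B i j) := by
    intro i j
    have h3 : (1 : ℝ) ≤ 3 ^ n := one_le_pow₀ (by norm_num)
    have h0 : (0 : ℝ) ≤ spineLength n i k := Nat.cast_nonneg _
    have hpi : ChainBounded (spineLength n i k : ℝ) (2 * 3 ^ n * spineLength n i k)
        (Subtype.val '' B i j) := by
      refine ChainBounded.pi (by positivity)
        (fun i' => if i' = i then {a | (a k).1 = 0} else A i i' j) ?_ ?_
      · rintro _ ⟨x, hx, rfl⟩ i'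
        by_cases h : i' = i
        · subst h; simpa using hx.1
        · simpa [h] using hx.2 i' h
      · intro i'
        by_cases h : i' = i
        · subst h
          simp only [if_true]
          refine (SpineTree.chainBounded_tips (spineLength_mono n i') k
            (spineLength_pos _ _ _)).mono subset_rfl le_rfl ?_
          nlinarith
        · simp only [h, if_false]
          refine (hAb i i' j).mono subset_rfl le_rfl ?_
          nlinarith
    exact (hpi.preimage Subtype.val (fun _ _ h => h) (fun _ _ h => h)).mono
      (fun x hx => ⟨x, hx, rfl⟩) le_rfl le_rfl
  have hunion : ∀ m : ℕ, m < n + 1 → ∀ j, ChainBounded (spineLength n 0 k : ℝ)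
      ((2 * 3 ^ n + 2) * spineLength n m k) {x | ∃ i : Fin (n + 1), i.val ≤ m ∧ x ∈ B i j} := by
    intro m hm j
    have hm0 : (spineLength n 0 k : ℝ) ≤ spineLength n m k := by
      exact_mod_cast Nat.pow_le_pow_right (by positivity) (by omega)
    have h0 : (0 : ℝ) < spineLength n 0 k := by exact_mod_cast spineLength_pos n 0 k
    induction m with
    | zero =>
      refine (hB 0 j).mono ?_ le_rfl ?_
      · rintro x ⟨i, hi, hx⟩
        rwa [show i = 0 from Fin.ext (Nat.le_zero.1 hi)] at hx
      · simp only [Fin.val_zero]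
        nlinarith
    | succ m ih =>
      have hm1 : (spineLength n 0 k : ℝ) ≤ spineLength n m k := by
        exact_mod_cast Nat.pow_le_pow_right (by positivity) (by omega)
      have hsucc : (spineLength n (m + 1) k : ℝ) = (2 * 3 ^ n + 5) * spineLength n m k := by
        exact_mod_cast spineLength_succ n m k
      refine ((ih (by omega) hm1).union (by positivity) h0.le (hB ⟨m + 1, hm⟩ j) ?_).mono ?_ le_rfl ?_
      · rw [hsucc]
        nlinarith
      · rintro x ⟨i, hi, hx⟩
        rcases Nat.le_succ_iff.1 hi with h | h
        · exact .inl ⟨i, h, hx⟩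
        · exact .inr (by rwa [show i = ⟨m + 1, hm⟩ from Fin.ext h] at hx)
      · rw [hsucc]
        nlinarith
  refine ⟨(2 * 3 ^ n + 2) * spineLength n n k, fun j => {x | ∃ i, x ∈ B i j},
    fun x => ?_, fun j => ?_⟩
  · obtain ⟨i, j, h⟩ := hcov x
    exact ⟨j, i, h⟩
  · refine (hunion n (by omega) j).mono ?_ ?_ le_rfl
    · rintro x ⟨i, hi⟩
      exact ⟨i, by omega, hi⟩
    · refine hk.le.trans ?_
      exact_mod_cast (lt_spineLength n 0 k).le

end UniversalSpace

/-- A separable space of asymptotic dimension at most `n` has `n + 1` countably labelled covering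
sets, each containing a given ball, whose label classes are bounded and far apart. -/
theorem AsdimLE.exists_labelled_cover {X : Type*} [MetricSpace X]
    [TopologicalSpace.SeparableSpace X] {n : ℕ} (h : AsdimLE X n) (L r : ℝ) (hr : 0 ≤ r) (x₀ : X) :
    ∃ (b : ℝ) (A : Fin (n + 1) → Set X) (label : Fin (n + 1) → X → ℕ), 0 ≤ b ∧
      (∀ x, ∃ i, x ∈ A i) ∧ (∀ i x, dist x x₀ ≤ r → x ∈ A i ∧ label i x = 0) ∧
      (∀ i, ∀ x ∈ A i, ∀ y ∈ A i, dist x y < L → label i x = label i y) ∧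
      ∀ i, ∀ x ∈ A i, ∀ y ∈ A i, label i x = label i y → dist x y ≤ b := by
  classical
  have : Nonempty X := ⟨x₀⟩
  set D := max L 1 with hD
  have hD1 : 1 ≤ D := le_max_right _ _
  have hLD : L ≤ D := le_max_left _ _
  obtain ⟨U, hU, ⟨C, hC, hb⟩, hd⟩ := h D (by linarith)
  have huniq : ∀ i, ∀ V ∈ U i, ∀ W ∈ U i, ∀ x ∈ V, ∀ y ∈ W, dist x y < D → V = W := by
    intro i V hV W hW x hx y hy hxy
    by_contra hne
    exact absurd (hd i V hV W hW hne x hx y hy) (not_le.2 hxy)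
  have hself : ∀ x : X, dist x x < D := fun x => by rw [dist_self]; linarith
  have hbd : ∀ i, ∀ V ∈ U i, ∀ x ∈ V, ∀ y ∈ V, dist x y ≤ C := fun i V hV =>
    hb V (Set.mem_iUnion.2 ⟨i, hV⟩)
  let Z : Fin (n + 1) → Set X := fun i => {x | dist x x₀ ≤ r ∨
    ∃ V ∈ U i, x ∈ V ∧ ∃ v ∈ V, ∃ z, dist z x₀ ≤ r ∧ dist v z < D}
  let T : Fin (n + 1) → X → Set ℕ := fun i x => {m | ∃ V ∈ U i, x ∈ V ∧
    ∃ v ∈ V, dist (TopologicalSpace.denseSeq X m) v < D / 2}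
  have hT : ∀ i, ∀ V ∈ U i, ∀ x ∈ V, (T i x).Nonempty := by
    intro i V hV x hx
    obtain ⟨m, hm⟩ := (TopologicalSpace.denseRange_denseSeq X).exists_dist_lt x
      (show 0 < D / 2 by linarith)
    exact ⟨m, V, hV, hx, x, hx, by rwa [dist_comm]⟩
  have hZ : ∀ i, ∀ x ∈ Z i, dist x x₀ ≤ C + D + r := by
    rintro i x (hx | ⟨V, hV, hxV, v, hv, z, hz, hvz⟩)
    · linarith
    · linarith [dist_triangle x v x₀, dist_triangle v z x₀, hbd i V hV x hxV v hv]
  refine ⟨2 * (C + D + r), fun i => ⋃₀ U i ∪ {x | dist x x₀ ≤ r},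
    fun i x => if x ∈ Z i then 0 else sInf (T i x) + 1, by linarith, ?_, ?_, ?_, ?_⟩
  · intro x
    obtain ⟨i, hi⟩ := Set.mem_iUnion.1 (hU ▸ Set.mem_univ x : x ∈ ⋃ i, ⋃₀ U i)
    exact ⟨i, .inl hi⟩
  · exact fun i x hx => ⟨.inr hx, if_pos (.inl hx)⟩
  · intro i
    have hZstep : ∀ x ∈ Z i, ∀ y ∈ ⋃₀ U i ∪ {x | dist x x₀ ≤ r}, dist x y < D → y ∈ Z i := by
      rintro x hx y (⟨W, hW, hy⟩ | hy) hxy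
      · rcases hx with hx | ⟨V, hV, hxV, hnear⟩
        · exact .inr ⟨W, hW, hy, y, hy, x, hx, by rwa [dist_comm]⟩
        · obtain rfl := huniq i V hV W hW x hxV y hy hxy
          exact .inr ⟨V, hV, hy, hnear⟩
      · exact .inl hy
    intro x hx y hy hxy
    have hxy := hxy.trans_le hLD
    dsimp only at hx hy ⊢
    by_cases hxZ : x ∈ Z i
    · rw [if_pos hxZ, if_pos (hZstep x hxZ y hy hxy)]
    · have hyZ : y ∉ Z i := fun h => hxZ (hZstep y h x hx (by rwa [dist_comm]))
      rw [if_neg hxZ, if_neg hyZ]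
      obtain ⟨V, hV, hxV⟩ := hx.resolve_right fun h => hxZ (.inl h)
      obtain ⟨W, hW, hyW⟩ := hy.resolve_right fun h => hyZ (.inl h)
      obtain rfl := huniq i V hV W hW x hxV y hyW hxy
      have : T i x = T i y := by
        ext m
        constructor
        · rintro ⟨V', hV', hx', hm⟩
          obtain rfl := huniq i V' hV' V hV x hx' x hxV (hself x)
          exact ⟨V', hV', hyW, hm⟩
        · rintro ⟨V', hV', hy', hm⟩
          obtain rfl := huniq i V' hV' V hV y hy' y hyW (hself y)
          exact ⟨V', hV', hxV, hm⟩
      rw [this]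
  · intro i x hx y hy hxy
    by_cases hxZ : x ∈ Z i
    · by_cases hyZ : y ∈ Z i
      · linarith [dist_triangle_right x y x₀, hZ i x hxZ, hZ i y hyZ]
      · simp [hxZ, hyZ] at hxy
    · by_cases hyZ : y ∈ Z i
      · simp [hxZ, hyZ] at hxy
      · simp only [hxZ, hyZ, if_false, add_left_inj] at hxy
        obtain ⟨V, hV, hxV⟩ := hx.resolve_right fun h => hxZ (.inl h)
        obtain ⟨W, hW, hyW⟩ := hy.resolve_right fun h => hyZ (.inl h)
        obtain ⟨V', hV', hxV', v, hv, hv'⟩ := Nat.sInf_mem (hT i V hV x hxV)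
        obtain ⟨W', hW', hyW', w, hw, hw'⟩ := Nat.sInf_mem (hT i W hW y hyW)
        rw [hxy] at hv'
        obtain rfl := huniq i V' hV' W' hW' v hv w hw (by
          linarith [dist_triangle_left v w (TopologicalSpace.denseSeq X (sInf (T i y)))])
        linarith [hbd i V' hV' x hxV' y hyW']

/-- Two points lie in a common cell, given deficiencies `g`, labels `l` and the spine length. -/
def SameCell {X : Type*} (D : ℕ) (g l : X → ℕ) (x y : X) : Prop :=
  0 < D - g x ∧ 0 < D - g y ∧ l x = l y

/-- The coordinates of one level, with respect to the metric in which the cells of the previous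
levels are collapsed to the values of `r`. -/
theorem exists_spine_coordinates {X : Type*} [MetricSpace X] {A : Set X} (hA : A.Nonempty)
    (label : X → ℕ) (r : X → X) {S b L : ℝ} {D : ℕ} (hS : 0 ≤ S) (hb : 0 ≤ b) (hD : 0 < D)
    (hr : ∀ x, dist x (r x) ≤ S)
    (hlabel : ∀ x ∈ A, ∀ y ∈ A, dist x y < L → label x = label y)
    (hbound : ∀ x ∈ A, ∀ y ∈ A, label x = label y → dist x y ≤ b)
    (hL : 2 * D * (1 + 2 * S) + 2 * S ≤ L) :
    ∃ (g l : X → ℕ) (r' : X → X),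
      (∀ x y, r x = r y → g x = g y ∧ l x = l y ∧ r' x = r' y) ∧
      (∀ x y, SameCell D g l x y → r' x = r' y ∧ dist x y ≤ S + 2 * L + b ∧
        (Nat.dist (D - g x) (D - g y) : ℝ) ≤ dist x y + 2) ∧
      (∀ x y, ¬ SameCell D g l x y → ((D - g x + (D - g y) : ℕ) : ℝ) ≤ 2 * dist x y + 4) ∧
      (∀ x ∈ A, g x = 0 ∧ l x = label x) ∧ ∀ x, dist x (r' x) ≤ S + 2 * L + b := by
  classical
  have hs : 0 < 1 + 2 * S := by linarith
  have hD' : (1 : ℝ) ≤ D := by exact_mod_cast hD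
  have hL0 : 0 ≤ L := by nlinarith
  have hrr : ∀ x y, dist (r x) (r y) ≤ dist x y + 2 * S := fun x y => by
    linarith [dist_triangle4 (r x) x y (r y), hr x, hr y, dist_comm x (r x)]
  have hrr' : ∀ x y, dist x y ≤ dist (r x) (r y) + 2 * S := fun x y => by
    linarith [dist_triangle4 x (r x) (r y) y, hr x, hr y, dist_comm y (r y)]
  let F : X → ℝ := fun z => Metric.infDist z (r '' A) / (1 + 2 * S)
  have hF0 : ∀ z, 0 ≤ F z := fun z => div_nonneg Metric.infDist_nonneg hs.le
  have hF : ∀ x y, F (r x) ≤ F (r y) + (dist x y + 1) := by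
    intro x y
    have h1 := Metric.infDist_le_infDist_add_dist (s := r '' A) (x := r x) (y := r y)
    have h2 : dist (r x) (r y) ≤ (dist x y + 1) * (1 + 2 * S) := by
      nlinarith [hrr x y, dist_nonneg (x := x) (y := y)]
    simp only [F]
    rw [div_add' _ _ _ hs.ne', div_le_div_iff_of_pos_right hs]
    linarith
  have hFlt : ∀ z (c : ℝ), F z < c → ∃ a ∈ A, dist z (r a) < c * (1 + 2 * S) := by
    intro z c h
    rw [div_lt_iff₀ hs, Metric.infDist_lt_iff (hA.image r)] at h
    obtain ⟨_, ⟨a, ha, rfl⟩, h⟩ := h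
    exact ⟨a, ha, h⟩
  let lab : X → ℕ := fun z =>
    if h : ∃ a ∈ A, dist z (r a) < D * (1 + 2 * S) then label h.choose else 0
  have hlab : ∀ z, ∀ a ∈ A, dist z (r a) < D * (1 + 2 * S) → lab z = label a := by
    intro z a ha hza
    have h : ∃ a ∈ A, dist z (r a) < D * (1 + 2 * S) := ⟨a, ha, hza⟩
    simp only [lab, dif_pos h]
    refine hlabel _ h.choose_spec.1 _ ha (lt_of_lt_of_le ?_ hL)
    linarith [hrr' h.choose a, dist_triangle_left (r h.choose) (r a) z, h.choose_spec.2]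
  let g : X → ℕ := fun x => ⌈F (r x)⌉₊
  let l : X → ℕ := fun x => lab (r x)
  have hpos : ∀ x, 0 < D - g x → F (r x) < D := by
    intro x hx
    have h1 : g x ≤ D - 1 := by omega
    have h2 : (g x : ℝ) < D := by exact_mod_cast (show g x < D by omega)
    exact (Nat.le_ceil _).trans_lt h2
  have hg : ∀ x, (g x : ℝ) < F (r x) + 1 := fun x => Nat.ceil_lt_add_one (hF0 _)
  have hanchor : ∀ x, 0 < D - g x → ∃ a ∈ A, l x = label a ∧ dist x a ≤ L := by
    intro x hx
    obtain ⟨a, ha, hxa⟩ := hFlt _ _ (hpos x hx)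
    exact ⟨a, ha, hlab _ a ha hxa, by nlinarith [hrr' x a]⟩
  have hcell : ∀ x y, SameCell D g l x y → dist x y ≤ S + 2 * L + b := by
    rintro x y ⟨hx, hy, hxy⟩
    obtain ⟨a, ha, hla, hxa⟩ := hanchor x hx
    obtain ⟨c, hc, hlc, hyc⟩ := hanchor y hy
    have := hbound a ha c hc (by rw [← hla, ← hlc, hxy])
    linarith [dist_triangle4 x a c y, dist_comm y c]
  let r' : X → X := fun x =>
    if h : 0 < D - g x ∧ ∃ y, 0 < D - g y ∧ l y = l x then h.2.choose else r x
  have hr' : ∀ x (h : 0 < D - g x ∧ ∃ y, 0 < D - g y ∧ l y = l x), r' x = h.2.choose :=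
    fun x h => dif_pos h
  refine ⟨g, l, r', ?_, ?_, ?_, ?_, ?_⟩
  · intro x y hxy
    have h1 : g x = g y := by simp only [g, hxy]
    have h2 : l x = l y := by simp only [l, hxy]
    refine ⟨h1, h2, ?_⟩
    simp only [r', h1, h2, hxy]
  · rintro x y h
    refine ⟨?_, hcell x y h, ?_⟩
    · obtain ⟨hx, hy, hxy⟩ := h
      rw [hr' x ⟨hx, x, hx, rfl⟩, hr' y ⟨hy, y, hy, rfl⟩]
      simp only [hxy]
    · have h1 := hF x y
      have h2 := hF y x
      have hx : F (r x) ≤ g x := Nat.le_ceil _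
      have hy : F (r y) ≤ g y := Nat.le_ceil _
      have hgx := hg x
      have hgy := hg y
      rw [dist_comm y x] at h2
      have hle : Nat.dist (D - g x) (D - g y) = g x - g y + (g y - g x) := by
        have := h.1; have := h.2.1
        simp only [Nat.dist]; omega
      rw [hle]
      rcases le_total (g x) (g y) with h3 | h3
      · rw [Nat.sub_eq_zero_of_le h3, zero_add, Nat.cast_sub h3]
        linarith
      · rw [Nat.sub_eq_zero_of_le h3, add_zero, Nat.cast_sub h3]
        linarith
  · have key : ∀ x y, ¬ SameCell D g l x y → ((D - g x : ℕ) : ℝ) ≤ dist x y + 2 := by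
      intro x y h
      by_contra! hlt
      have hd := dist_nonneg (x := x) (y := y)
      have hx : 0 < D - g x := by
        have : (0 : ℝ) < (D - g x : ℕ) := by linarith
        exact_mod_cast this
      rw [Nat.cast_sub (by omega)] at hlt
      have hFx : F (r x) ≤ g x := Nat.le_ceil _
      have hFy := hF y x
      rw [dist_comm y x] at hFy
      have hy : 0 < D - g y := by
        have : (g y : ℝ) < D := by linarith [hg y]
        have : g y < D := by exact_mod_cast this
        omega
      obtain ⟨a, ha, hxa⟩ := hFlt (r x) (D - (dist x y + 1)) (by linarith)
      refine h ⟨hx, hy, (hlab _ a ha ?_).trans (hlab _ a ha ?_).symm⟩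
      · nlinarith
      · have h2 : dist (r x) (r y) ≤ (dist x y + 1) * (1 + 2 * S) := by
          nlinarith [hrr x y]
        nlinarith [dist_triangle_left (r y) (r a) (r x)]
    intro x y h
    have h1 := key x y h
    have h2 := key y x fun h' => h ⟨h'.2.1, h'.1, h'.2.2.symm⟩
    rw [dist_comm y x] at h2
    push_cast
    linarith
  · intro x hx
    have h0 : F (r x) = 0 := by
      simp only [F, Metric.infDist_zero_of_mem (Set.mem_image_of_mem r hx), zero_div]
    refine ⟨by simp [g, h0], hlab _ x hx ?_⟩
    rw [dist_self]
    positivity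
  · intro x
    by_cases hx : 0 < D - g x
    · have h : 0 < D - g x ∧ ∃ y, 0 < D - g y ∧ l y = l x := ⟨hx, x, hx, rfl⟩
      rw [hr' x h]
      exact hcell _ _ ⟨hx, h.2.choose_spec.1, h.2.choose_spec.2.symm⟩
    · have : r' x = r x := dif_neg fun h => hx h.1
      rw [this]
      linarith [hr x]

open UniversalSpace in
theorem AsdimLE.exists_isLargeScaleEmbedding {X : Type*} [MetricSpace X]
    [TopologicalSpace.SeparableSpace X] {n : ℕ} (h : AsdimLE X n) :
    ∃ f : X → UniversalSpace n, IsLargeScaleEmbedding f := by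
  rcases isEmpty_or_nonempty X with hX | ⟨⟨x₀⟩⟩
  · exact ⟨fun x => hX.elim x, isLargeScaleEmbedding_of_forall 0 (fun x => hX.elim x)
      fun k => ⟨0, fun x => hX.elim x⟩⟩
  let St := {p : (Fin (n + 1) → X → X) × ℝ // 0 ≤ p.2 ∧ ∀ i x, dist x (p.1 i x) ≤ p.2}
  have hstep : ∀ (k : ℕ) (p : St), ∃ (g l : Fin (n + 1) → X → ℕ) (q : St),
      (∀ (i : Fin (n + 1)) x y, p.1.1 i x = p.1.1 i y →
        g i x = g i y ∧ l i x = l i y ∧ q.1.1 i x = q.1.1 i y) ∧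
      (∀ (i : Fin (n + 1)) x y, SameCell (spineLength n i k) (g i) (l i) x y →
        q.1.1 i x = q.1.1 i y ∧ dist x y ≤ q.1.2 ∧
        (Nat.dist (spineLength n i k - g i x) (spineLength n i k - g i y) : ℝ) ≤ dist x y + 2) ∧
      (∀ (i : Fin (n + 1)) x y, ¬ SameCell (spineLength n i k) (g i) (l i) x y →
        ((spineLength n i k - g i x + (spineLength n i k - g i y) : ℕ) : ℝ) ≤ 2 * dist x y + 4) ∧
      (∀ x, ∃ i, g i x = 0) ∧ ∀ i x, dist x x₀ ≤ k → g i x = 0 ∧ l i x = 0 := by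
    rintro k ⟨⟨r, S⟩, hS, hr⟩
    dsimp only at hS hr ⊢
    set L := 2 * (∑ i : Fin (n + 1), spineLength n i k : ℕ) * (1 + 2 * S) + 2 * S with hL
    obtain ⟨b, A, label, hb, hcov, hball, hlabel, hbound⟩ :=
      h.exists_labelled_cover L k (Nat.cast_nonneg k) x₀
    have hDL : ∀ i : Fin (n + 1), 2 * (spineLength n i k : ℝ) * (1 + 2 * S) + 2 * S ≤ L := by
      intro i
      have : (spineLength n i k : ℝ) ≤ (∑ i : Fin (n + 1), spineLength n i k : ℕ) := by
        exact_mod_cast Finset.single_le_sum (f := fun i : Fin (n + 1) => spineLength n i k)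
          (fun _ _ => Nat.zero_le _) (Finset.mem_univ i)
      rw [hL]
      gcongr
    have hx₀ : ∀ i, x₀ ∈ A i := fun i => (hball i x₀ (by simp)).1
    choose g l r' h1 h2 h3 h4 h5 using fun i => exists_spine_coordinates ⟨x₀, hx₀ i⟩ (label i)
      (r i) hS hb (spineLength_pos n i k) (hr i) (hlabel i) (hbound i) (hDL i)
    have hL0 : 0 ≤ L := by positivity
    refine ⟨g, l, ⟨(r', S + 2 * L + b), by dsimp only; positivity, h5⟩, h1, h2, h3, ?_, ?_⟩
    · intro x
      obtain ⟨i, hi⟩ := hcov x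
      exact ⟨i, (h4 i x hi).1⟩
    · intro i x hx
      obtain ⟨hxA, hx0⟩ := hball i x hx
      exact ⟨(h4 i x hxA).1, (h4 i x hxA).2.trans hx0⟩
  choose g l q hcongr hcell hncell hdeep hzero using hstep
  let p : ℕ → St := fun k => Nat.rec ⟨(fun _ x => x, 0), le_rfl, fun _ x => by simp⟩ q k
  have hp : ∀ k, p (k + 1) = q k (p k) := fun _ => rfl
  have htail : ∀ i x y k, (p k).1.1 i x = (p k).1.1 i y →
      ∀ j, k ≤ j → (p j).1.1 i x = (p j).1.1 i y := by
    intro i x y k hk j hj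
    induction j, hj using Nat.le_induction with
    | base => exact hk
    | succ j _ ih => exact (hcongr j (p j) i x y ih).2.2
  let c : X → ∀ i : Fin (n + 1), SpineTree (spineLength n i) := fun x i =>
    Finsupp.ofSupportFinite (fun k => (g k (p k) i x, l k (p k) i x)) (by
      refine (Set.finite_Iio ⌈dist x x₀⌉₊).subset fun k hk => ?_
      by_contra hlt
      obtain ⟨h1, h2⟩ := hzero k (p k) i x (Nat.ceil_le.1 (not_lt.1 hlt))
      exact hk (Prod.ext h1 h2))
  have hc : ∀ x i k, c x i k = (g k (p k) i x, l k (p k) i x) := fun _ _ _ => rfl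
  have hheight : ∀ x i k, (c x i).height k = spineLength n i k - g k (p k) i x := fun _ _ _ => rfl
  have hspine : ∀ x y i k, SpineTree.SameSpine (c x i) (c y i) k ↔
      SameCell (spineLength n i k) (g k (p k) i) (l k (p k) i) x y := by
    intro x y i k
    refine ⟨fun h => ⟨h.1, h.2.1, h.2.2.1⟩, fun h => ⟨h.1, h.2.1, h.2.2, fun j hj => ?_⟩⟩
    have h1 := htail i x y (k + 1) (hcell k (p k) i x y h).1 j hj
    obtain ⟨h2, h3, -⟩ := hcongr j (p j) i x y h1
    rw [hc, hc, h2, h3]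
  refine ⟨fun x => ⟨c x, fun k => hdeep k (p k) x⟩, isLargeScaleEmbedding_of_forall 4 ?_ ?_⟩
  · intro x y
    have hd := dist_nonneg (x := x) (y := y)
    refine (dist_le_iff (by positivity)).2 fun i => ?_
    refine le_trans (SpineTree.dist_le_natCast (C := ⌊2 * dist x y + 4⌋₊) ?_ fun k => ?_)
      (Nat.floor_le (by positivity))
    · exact Nat.le_floor (by push_cast; linarith)
    · refine Nat.le_floor ?_
      by_cases h : SpineTree.SameSpine (c x i) (c y i) k
      · rw [SpineTree.levelDist_of_sameSpine h]
        refine ((hcell k (p k) i x y ((hspine x y i k).1 h)).2.2).trans ?_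
        linarith
      · rw [SpineTree.levelDist_of_not_sameSpine h]
        exact hncell k (p k) i x y fun h' => h ((hspine x y i k).2 h')
  · intro k
    refine ⟨(p (k + 1)).1.2, fun x y hxy => ?_⟩
    obtain ⟨i, hi⟩ := hdeep k (p k) x
    refine (hcell k (p k) i x y ((hspine x y i k).1 ?_)).2.1
    by_contra h
    have h1 := (SpineTree.levelDist_le_dist (c x i) (c y i) k).trans
      ((dist_le_iff (Nat.cast_nonneg k)).1 hxy i)
    rw [SpineTree.levelDist_of_not_sameSpine h, hheight, hi] at h1
    have h2 : spineLength n i k - 0 + (c y i).height k ≤ k := by exact_mod_cast h1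
    have := lt_spineLength n i k
    omega

namespace Kuhn

open Finset

/-- The `j`-th vertex of the simplex of Kuhn's triangulation of `ℤⁿ` given by a base point and a
permutation. -/
def vertex {n : ℕ} (x : Fin n → ℤ) (τ : Equiv.Perm (Fin n)) (j : ℕ) : Fin n → ℤ :=
  fun k => x k + if (τ k : ℕ) < j then 1 else 0

/-- The `j`-th face of a sequence of vertices. -/
def face {V : Type*} (j : ℕ) (v : ℕ → V) (l : ℕ) : V := v (if l < j then l else l + 1)

theorem le_vertex {n : ℕ} (x : Fin n → ℤ) (τ : Equiv.Perm (Fin n)) (j : ℕ) (k : Fin n) :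
    x k ≤ vertex x τ j k := by
  unfold vertex; split_ifs <;> omega

theorem vertex_le {n : ℕ} (x : Fin n → ℤ) (τ : Equiv.Perm (Fin n)) (j : ℕ) (k : Fin n) :
    vertex x τ j k ≤ x k + 1 := by
  unfold vertex; split_ifs <;> omega

/-- The product of the increments of `φ l` along the edges of a path, modulo 2. -/
def cup {V : Type*} (n : ℕ) (φ : ℕ → V → ZMod 2) (v : ℕ → V) : ZMod 2 :=
  ∏ l ∈ range n, (φ l (v (l + 1)) + φ l (v l))

theorem cup_succ {V : Type*} (n : ℕ) (φ : ℕ → V → ZMod 2) (v : ℕ → V) :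
    cup (n + 1) φ v =
      (φ 0 (v 1) + φ 0 (v 0)) * cup n (fun l => φ (l + 1)) (fun l => v (l + 1)) := by
  rw [cup, prod_range_succ', mul_comm]; rfl

theorem cup_congr {V : Type*} {n : ℕ} {φ : ℕ → V → ZMod 2} {v w : ℕ → V}
    (h : ∀ l, l ≤ n → v l = w l) : cup n φ v = cup n φ w := by
  refine prod_congr rfl fun l hl => ?_
  have := mem_range.1 hl
  rw [h l (by omega), h (l + 1) (by omega)]

theorem two_eq_zero : (2 : ZMod 2) = 0 := rfl

theorem sum_cup_face_succ {V : Type*} (n : ℕ) (φ : ℕ → V → ZMod 2) (v : ℕ → V) :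
    ∑ j ∈ range (n + 1), cup n φ (face (j + 1) v) = cup n φ fun l => v (l + 1) := by
  induction n generalizing φ v with
  | zero => simp [cup]
  | succ n ih =>
    rw [sum_range_succ']
    have h : ∀ j, cup (n + 1) φ (face (j + 1 + 1) v) = (φ 0 (v 1) + φ 0 (v 0)) *
        cup n (fun l => φ (l + 1)) (face (j + 1) fun l => v (l + 1)) := by
      intro j
      rw [cup_succ]
      congr 2
      funext l
      simp only [face, Nat.add_lt_add_iff_right]
      split_ifs <;> rfl
    simp only [h, ← mul_sum, ih]
    rw [cup_succ, cup_succ n φ fun l => v (l + 1)]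
    have h' : (fun l => face (0 + 1) v (l + 1)) = fun l => v (l + 1 + 1) := by
      funext l; simp [face]
    rw [h']
    simp only [face]
    norm_num
    linear_combination (φ 0 (v 0) * cup n (fun l => φ (l + 1)) fun l => v (l + 1 + 1)) * two_eq_zero

/-- The coboundary of `ψ ∪ dφ₀ ∪ dφ₁ ∪ ⋯`. -/
theorem sum_mul_cup_face {V : Type*} (n : ℕ) (ψ : V → ZMod 2) (φ : ℕ → V → ZMod 2) (v : ℕ → V) :
    ∑ j ∈ range (n + 2), ψ (face j v 0) * cup n φ (face j v) =
      (ψ (v 1) + ψ (v 0)) * cup n φ fun l => v (l + 1) := by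
  rw [sum_range_succ']
  have h : ∀ j, face (j + 1) v 0 = v 0 := fun j => by simp [face]
  simp only [h, ← mul_sum, sum_cup_face_succ]
  have h' : face 0 v = fun l => v (l + 1) := by funext l; simp [face]
  rw [h']
  ring

theorem sum_eq_zero_of_involution {α : Type*} [Fintype α] (g : α → ZMod 2) (s : α → α)
    (hs : ∀ a, s (s a) = a) (hne : ∀ a, s a ≠ a) (hg : ∀ a, g (s a) = g a) : ∑ a, g a = 0 := by
  refine sum_involution (fun a _ => s a) (fun a _ => ?_) (fun a _ _ => hne a) (fun a _ => mem_univ _)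
    (fun a _ => hs a)
  rw [hg]
  linear_combination g a * two_eq_zero

theorem face_vertex_swap {n : ℕ} (x : Fin (n + 1) → ℤ) (τ : Equiv.Perm (Fin (n + 1))) {j : ℕ}
    (hj : j < n) (l : ℕ) :
    face (j + 1) (vertex x (Equiv.swap ⟨j, by omega⟩ ⟨j + 1, by omega⟩ * τ)) l =
      face (j + 1) (vertex x τ) l := by
  have h : ∀ m : Fin (n + 1), (Equiv.swap (⟨j, by omega⟩ : Fin (n + 1)) ⟨j + 1, by omega⟩ m).val <
      (if l < j + 1 then l else l + 1) ↔ m.val < if l < j + 1 then l else l + 1 := by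
    intro m
    rw [Equiv.swap_apply_def]
    split_ifs <;> simp_all [Fin.ext_iff] <;> omega
  funext k
  exact congrArg (x k + ·) (if_congr (h (τ k)) rfl rfl)

theorem vertex_succ_eq {n : ℕ} (x : Fin (n + 1) → ℤ) (τ : Equiv.Perm (Fin (n + 1))) {l : ℕ}
    (hl : l ≤ n) :
    vertex x τ (l + 1) = vertex (x + fun k => if τ k = 0 then 1 else 0)
      ((finRotate (n + 1))⁻¹ * τ) l := by
  funext k
  obtain ⟨m, hm⟩ : ∃ m, finRotate (n + 1) m = τ k := ⟨(finRotate (n + 1)).symm (τ k), by simp⟩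
  have : ((finRotate (n + 1))⁻¹ * τ) k = m := by
    rw [Equiv.Perm.mul_apply, ← hm]; simp
  simp only [vertex, this, Pi.add_apply, ← Fin.val_eq_zero_iff]
  rcases eq_or_ne m (Fin.last n) with rfl | h
  · have h1 : (τ k).val = 0 := by rw [← hm]; simp
    simp [h1]
    omega
  · have h1 : (τ k).val = m.val + 1 := by rw [← hm]; exact coe_finRotate_of_ne_last h
    simp [h1]

/-- Stokes' theorem modulo 2 for Kuhn's triangulation: the interior faces cancel in pairs. -/
theorem sum_faces_eq_zero {n : ℕ} (c : (ℕ → Fin (n + 1) → ℤ) → ZMod 2)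
    (hc : ∀ v w : ℕ → Fin (n + 1) → ℤ, (∀ l, l ≤ n → v l = w l) → c v = c w) :
    ∑ j ∈ range (n + 2), ∑ τ : Equiv.Perm (Fin (n + 1)), ∑ᶠ x, c (face j (vertex x τ)) = 0 := by
  rw [sum_range_succ, sum_range_succ']
  have hint : ∀ j ∈ range n, ∑ τ : Equiv.Perm (Fin (n + 1)),
      ∑ᶠ x, c (face (j + 1) (vertex x τ)) = 0 := by
    intro j hj
    have hj := mem_range.1 hj
    refine sum_eq_zero_of_involution _
      (fun τ => Equiv.swap (⟨j, by omega⟩ : Fin (n + 1)) ⟨j + 1, by omega⟩ * τ) ?_ ?_ ?_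
    · intro τ
      rw [← mul_assoc, Equiv.swap_mul_self, one_mul]
    · intro τ h
      rw [mul_eq_right, Equiv.swap_eq_one_iff] at h
      simp at h
    · intro τ
      exact finsum_congr fun x => hc _ _ fun l _ => face_vertex_swap x τ hj l
  have hend : ∑ τ : Equiv.Perm (Fin (n + 1)), ∑ᶠ x, c (face 0 (vertex x τ)) =
      ∑ τ : Equiv.Perm (Fin (n + 1)), ∑ᶠ x, c (face (n + 1) (vertex x τ)) := by
    rw [← Equiv.sum_comp (Equiv.mulLeft (finRotate (n + 1))⁻¹)
      fun τ => ∑ᶠ x, c (face (n + 1) (vertex x τ))]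
    refine sum_congr rfl fun τ _ => ?_
    refine Eq.trans (finsum_congr fun x => hc _ _ fun l hl => ?_)
      (finsum_comp_equiv (Equiv.addRight fun k => if τ k = 0 then (1 : ℤ) else 0)
        (f := fun x => c (face (n + 1) (vertex x ((finRotate (n + 1))⁻¹ * τ)))))
    simp only [face, Nat.not_lt_zero, if_false, if_pos (Nat.lt_succ_of_le hl)]
    exact vertex_succ_eq x τ hl
  rw [sum_eq_zero hint, hend, zero_add]
  linear_combination (∑ τ : Equiv.Perm (Fin (n + 1)), ∑ᶠ x, c (face (n + 1) (vertex x τ))) *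
    two_eq_zero

theorem ne_of_cup_ne_zero {V : Type*} {n : ℕ} {φ : ℕ → V → ZMod 2} {v : ℕ → V}
    (h : cup n φ v ≠ 0) {l : ℕ} (hl : l < n) : φ l (v (l + 1)) ≠ φ l (v l) := by
  intro h'
  refine prod_ne_zero_iff.1 h l (mem_range.2 hl) ?_
  rw [h']
  linear_combination φ l (v l) * two_eq_zero

/-- The function is 1 to the left of the slab `0 < x k < N` and 0 to its right. -/
def Crosses {n : ℕ} (N : ℤ) (φ : (Fin n → ℤ) → ZMod 2) (k : Fin n) : Prop :=
  (∀ x, x k ≤ 0 → φ x = 1) ∧ ∀ x, N ≤ x k → φ x = 0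

theorem Crosses.mem_of_ne {n : ℕ} {N : ℤ} {φ : (Fin n → ℤ) → ZMod 2} {k : Fin n}
    (h : Crosses N φ k) {x u v : Fin n → ℤ} (hu : x k ≤ u k) (hu' : u k ≤ x k + 1)
    (hv : x k ≤ v k) (hv' : v k ≤ x k + 1) (hne : φ u ≠ φ v) : -1 ≤ x k ∧ x k ≤ N := by
  refine ⟨?_, ?_⟩
  · by_contra! hlt
    exact hne ((h.1 u (by omega)).trans (h.1 v (by omega)).symm)
  · by_contra! hlt
    exact hne ((h.2 u (by omega)).trans (h.2 v (by omega)).symm)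

theorem finite_box {n : ℕ} (N : ℤ) : {x : Fin n → ℤ | ∀ k, -1 ≤ x k ∧ x k ≤ N}.Finite := by
  refine (Set.finite_Icc (fun _ : Fin n => (-1 : ℤ)) fun _ => N).subset fun x hx => ?_
  exact ⟨fun k => (hx k).1, fun k => (hx k).2⟩

theorem finite_support_cup {n : ℕ} {N : ℤ} {φ : ℕ → (Fin n → ℤ) → ZMod 2}
    (hφ : ∀ k : Fin n, Crosses N (φ k) k) (τ : Equiv.Perm (Fin n)) :
    (Function.support fun x => cup n φ (vertex x τ)).Finite := by
  refine (finite_box N).subset fun x hx k => ?_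
  exact (hφ k).mem_of_ne (le_vertex _ _ _ _) (vertex_le _ _ _ _) (le_vertex _ _ _ _)
    (vertex_le _ _ _ _) (ne_of_cup_ne_zero hx k.2)

theorem sum_cup_eq_of_first {n : ℕ} {N : ℤ} {φ : ℕ → (Fin (n + 1) → ℤ) → ZMod 2}
    (hφ : ∀ k : Fin (n + 1), Crosses N (φ k) k) {ψ : (Fin (n + 1) → ℤ) → ZMod 2}
    (hψ : Crosses N ψ 0) :
    ∑ τ : Equiv.Perm (Fin (n + 1)), ∑ᶠ x, cup (n + 1) φ (vertex x τ) =
      ∑ τ : Equiv.Perm (Fin (n + 1)), ∑ᶠ x, (ψ (vertex x τ 1) + ψ (vertex x τ 0)) *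
        cup n (fun l => φ (l + 1)) fun l => vertex x τ (l + 1) := by
  have hst := sum_faces_eq_zero (n := n)
    (fun w => (φ 0 (w 0) + ψ (w 0)) * cup n (fun l => φ (l + 1)) w)
    (fun v w h => by rw [h 0 (Nat.zero_le _), cup_congr h])
  have hfin : ∀ j τ, (Function.support fun x => (φ 0 (face j (vertex x τ) 0) +
      ψ (face j (vertex x τ) 0)) * cup n (fun l => φ (l + 1)) (face j (vertex x τ))).Finite := by
    intro j τ
    refine (finite_box N).subset fun x hx k => ?_
    have hx1 := left_ne_zero_of_mul hx
    have hx2 := right_ne_zero_of_mul hx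
    induction k using Fin.cases with
    | zero =>
      have h1 := le_vertex x τ (if 0 < j then 0 else 0 + 1) 0
      have h2 := vertex_le x τ (if 0 < j then 0 else 0 + 1) 0
      simp only [face] at hx1
      have hφ0 := hφ 0
      simp only [Fin.val_zero] at hφ0
      refine ⟨?_, ?_⟩ <;> by_contra! hlt <;> apply hx1
      · rw [hφ0.1 _ (by omega), hψ.1 _ (by omega)]
        exact two_eq_zero
      · rw [hφ0.2 _ (by omega), hψ.2 _ (by omega), add_zero]
    | succ k =>
      have h := ne_of_cup_ne_zero hx2 k.2
      exact (hφ k.succ).mem_of_ne (le_vertex _ _ _ _) (vertex_le _ _ _ _) (le_vertex _ _ _ _)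
        (vertex_le _ _ _ _) h
  rw [sum_comm] at hst
  have key : ∀ τ : Equiv.Perm (Fin (n + 1)),
      ∑ j ∈ range (n + 2), ∑ᶠ x, (φ 0 (face j (vertex x τ) 0) +
        ψ (face j (vertex x τ) 0)) * cup n (fun l => φ (l + 1)) (face j (vertex x τ)) =
      ∑ᶠ x, cup (n + 1) φ (vertex x τ) + ∑ᶠ x, (ψ (vertex x τ 1) + ψ (vertex x τ 0)) *
        cup n (fun l => φ (l + 1)) fun l => vertex x τ (l + 1) := by
    intro τ
    rw [← finsum_sum_comm _ _ fun j _ => hfin j τ, ← finsum_add_distrib]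
    · refine finsum_congr fun x => ?_
      rw [sum_mul_cup_face n (fun u => φ 0 u + ψ u), cup_succ]
      ring
    · exact finite_support_cup hφ τ
    · have := finite_support_cup (φ := fun l => if l = 0 then ψ else φ l) (N := N)
        (fun k => by
          split_ifs with h
          · rw [show k = 0 from Fin.ext h]; exact hψ
          · exact hφ k) τ
      refine this.subset fun x hx => ?_
      rw [Function.mem_support, cup_succ]
      simpa using hx
  simp only [key, sum_add_distrib] at hst
  exact CharTwo.add_eq_zero.1 hst

theorem vertex_cons_succ {n : ℕ} (y : Fin n → ℤ) (σ : Equiv.Perm (Fin n)) (l : ℕ) :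
    vertex (Fin.cons 0 y : Fin (n + 1) → ℤ) (Equiv.Perm.decomposeFin.symm (0, σ)) (l + 1) =
      Fin.cons 1 (vertex y σ l) := by
  funext k
  induction k using Fin.cases with
  | zero => simp [vertex]
  | succ k => simp [vertex]

theorem sum_cup_eq_one {n : ℕ} {N : ℤ} (hN : 1 ≤ N) {φ : ℕ → (Fin n → ℤ) → ZMod 2}
    (hφ : ∀ k : Fin n, Crosses N (φ k) k) :
    ∑ τ : Equiv.Perm (Fin n), ∑ᶠ x, cup n φ (vertex x τ) = 1 := by
  induction n with
  | zero => simp [cup, finsum_unique]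
  | succ n ih =>
    rw [sum_cup_eq_of_first hφ (ψ := fun x => if x 0 ≤ 0 then 1 else 0)
      ⟨fun x hx => if_pos hx, fun x hx => if_neg (by omega)⟩]
    rw [← Equiv.Perm.decomposeFin.symm.sum_comp, Fintype.sum_prod_type, Fin.sum_univ_succ]
    have hvan : ∀ x (τ : Equiv.Perm (Fin (n + 1))), ¬ (x 0 = 0 ∧ τ 0 = 0) →
        ((if vertex x τ 1 0 ≤ 0 then (1 : ZMod 2) else 0) +
          if vertex x τ 0 0 ≤ 0 then 1 else 0) = 0 := by
      intro x τ h
      simp only [vertex, Nat.lt_one_iff, Fin.val_eq_zero_iff, Nat.not_lt_zero, if_false, add_zero]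
      by_cases h0 : τ 0 = 0
      · have : x 0 ≠ 0 := fun h' => h ⟨h', h0⟩
        simp only [h0, if_true]
        by_cases h1 : x 0 ≤ 0
        · rw [if_pos h1, if_pos (by omega)]; rfl
        · rw [if_neg h1, if_neg (by omega)]; rfl
      · simp only [h0, if_false, add_zero]
        split_ifs <;> rfl
    have hrest : ∑ p : Fin n, ∑ σ : Equiv.Perm (Fin n), ∑ᶠ x : Fin (n + 1) → ℤ,
        ((if vertex x (Equiv.Perm.decomposeFin.symm (p.succ, σ)) 1 0 ≤ 0 then (1 : ZMod 2) else 0) +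
          if vertex x (Equiv.Perm.decomposeFin.symm (p.succ, σ)) 0 0 ≤ 0 then 1 else 0) *
        cup n (fun l => φ (l + 1)) (fun l =>
          vertex x (Equiv.Perm.decomposeFin.symm (p.succ, σ)) (l + 1)) = 0 := by
      refine sum_eq_zero fun p _ => sum_eq_zero fun σ _ => ?_
      refine finsum_eq_zero_of_forall_eq_zero fun x => ?_
      rw [hvan x (Equiv.Perm.decomposeFin.symm (p.succ, σ)) (by simp), zero_mul]
    rw [hrest, add_zero]
    refine Eq.trans ?_ (ih (φ := fun l y => φ (l + 1) (Fin.cons 1 y)) ?_)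
    · refine sum_congr rfl fun σ _ => ?_
      have hinj : Function.Injective fun y : Fin n → ℤ => (Fin.cons 0 y : Fin (n + 1) → ℤ) :=
        Fin.cons_right_injective (α := fun _ => ℤ) 0
      have hsupp : ∀ f : (Fin (n + 1) → ℤ) → ZMod 2, (∀ x, x 0 ≠ 0 → f x = 0) →
          ∑ᶠ x, f x = ∑ᶠ y, f (Fin.cons 0 y) := by
        intro f hf
        rw [← finsum_mem_range hinj, ← finsum_mem_univ]
        refine finsum_mem_inter_support_eq _ _ _ ?_
        ext x
        simp only [Set.mem_inter_iff, Set.mem_univ, true_and, Function.mem_support, iff_and_self]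
        intro hx
        have h0 : x 0 = 0 := by
          by_contra h
          exact hx (hf x h)
        refine ⟨Fin.tail x, ?_⟩
        dsimp only
        rw [← h0, Fin.cons_self_tail]
      rw [hsupp]
      · refine finsum_congr fun y => ?_
        rw [vertex_cons_succ]
        simp only [vertex_cons_succ]
        simp [vertex, cup]
      · intro x hx
        rw [hvan x _ (fun h => hx h.1), zero_mul]
    · intro k
      exact ⟨fun y hy => (hφ k.succ).1 _ (by simpa using hy),
        fun y hy => (hφ k.succ).2 _ (by simpa using hy)⟩

/-- A discrete Poincaré–Miranda theorem. -/
theorem exists_cube {n : ℕ} {N : ℤ} (hN : 1 ≤ N) {φ : Fin n → (Fin n → ℤ) → ZMod 2}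
    (hφ : ∀ k : Fin n, Crosses N (φ k) k) :
    ∃ x : Fin n → ℤ, ∀ k, ∃ u v : Fin n → ℤ, (∀ i, x i ≤ u i ∧ u i ≤ x i + 1) ∧
      (∀ i, x i ≤ v i ∧ v i ≤ x i + 1) ∧ φ k u = 1 ∧ φ k v = 0 := by
  have h := sum_cup_eq_one hN (φ := fun l => if h : l < n then φ ⟨l, h⟩ else 0)
    (fun k => by simpa using hφ k)
  obtain ⟨τ, -, hτ⟩ := exists_ne_zero_of_sum_ne_zero (h ▸ one_ne_zero)
  obtain ⟨x, hx⟩ : ∃ x, cup n (fun l => if h : l < n then φ ⟨l, h⟩ else 0) (vertex x τ) ≠ 0 := by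
    by_contra! h'
    exact hτ (finsum_eq_zero_of_forall_eq_zero h')
  refine ⟨x, fun k => ?_⟩
  have hk := ne_of_cup_ne_zero hx k.2
  simp only [Fin.is_lt, dif_pos, Fin.eta] at hk
  have hz : ∀ a b : ZMod 2, a ≠ b → (a = 1 ∧ b = 0) ∨ (b = 1 ∧ a = 0) := by decide
  rcases hz _ _ hk with h | h
  · exact ⟨_, _, fun i => ⟨le_vertex _ _ _ i, vertex_le _ _ _ i⟩,
      fun i => ⟨le_vertex _ _ _ i, vertex_le _ _ _ i⟩, h⟩
  · exact ⟨_, _, fun i => ⟨le_vertex _ _ _ i, vertex_le _ _ _ i⟩,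
      fun i => ⟨le_vertex _ _ _ i, vertex_le _ _ _ i⟩, h⟩

end Kuhn

theorem int_dist_lt_iff {a b s : ℤ} : dist a b < (s : ℝ) ↔ |a - b| < s := by
  rw [Int.dist_eq]
  exact_mod_cast Iff.rfl

theorem exists_missesAtMostOne_int (s : ℕ) (hs : 0 < s) :
    ∃ A : Fin 2 → Set ℤ, MissesAtMostOne A ∧ ∀ i, ChainBounded (s : ℝ) (2 * s) (A i) := by
  have hs' : (0 : ℤ) < s := by exact_mod_cast hs
  refine ⟨fun i => {z | z / s % 2 = i.val}, fun z i j hij => ?_, fun i => ?_⟩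
  · have := Int.emod_two_eq_zero_or_one (z / s)
    simp only [Set.mem_ofPred_eq]
    have := Fin.val_ne_of_ne hij
    omega
  · refine ChainBounded.of_invariant (by positivity) (fun x y => x / s = y / s)
      (fun _ _ => rfl) ?_ ?_
    · intro x y z _ hy hz hxy hyz
      have h := abs_lt.1 (int_dist_lt_iff.1 (show dist y z < ((s : ℤ) : ℝ) by exact_mod_cast hyz))
      have hdiv : ∀ a : ℤ, (a + s) / s = a / s + 1 := fun a => by
        simpa using Int.add_mul_ediv_right a 1 hs'.ne'
      have h1 : y / s ≤ z / s + 1 := by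
        rw [← hdiv]
        exact Int.ediv_le_ediv hs' (by omega)
      have h2 : z / s ≤ y / s + 1 := by
        rw [← hdiv]
        exact Int.ediv_le_ediv hs' (by omega)
      simp only [Set.mem_ofPred_eq] at hy hz
      omega
    · intro x y hxy
      have hx := Int.emod_add_mul_ediv x s
      have hy := Int.emod_add_mul_ediv y s
      have hx1 := Int.emod_nonneg x hs'.ne'
      have hy1 := Int.emod_nonneg y hs'.ne'
      have hx2 := Int.emod_lt_of_pos x hs'
      have hy2 := Int.emod_lt_of_pos y hs'
      have : dist x y < ((2 * s : ℤ) : ℝ) := by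
        rw [int_dist_lt_iff, abs_lt]
        rw [hxy] at hx
        constructor <;> linarith
      exact_mod_cast this.le

theorem asdimLE_int_pi (n : ℕ) : AsdimLE (Fin n → ℤ) n := by
  rw [asdimLE_iff_chainBounded]
  intro s hs
  obtain ⟨N, hN⟩ := exists_nat_gt s
  have hN0 : 0 < N := by exact_mod_cast hs.trans hN
  obtain ⟨A, hA, hb⟩ := exists_missesAtMostOne exists_missesAtMostOne_int n N hN0
  refine ⟨3 ^ n * N, fun j => {x | ∀ i, x i ∈ A j}, fun x => ?_, fun j => ?_⟩
  · obtain ⟨j, hj⟩ := exists_common_color (fun _ : Fin n => A) (fun _ => hA) x (fun _ => True)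
      (by simp)
    exact ⟨j, fun i => hj i trivial⟩
  · exact ChainBounded.pi (by positivity) (fun _ => A j) (fun x hx => hx)
      fun _ => (hb j).mono subset_rfl hN.le le_rfl

theorem not_asdimLE_int_pi {m n : ℕ} (hmn : m < n) : ¬ AsdimLE (Fin n → ℤ) m := by
  classical
  rw [asdimLE_iff_chainBounded]
  intro h
  obtain ⟨b, A, hcov, hA⟩ := h 3 (by norm_num)
  let R : Fin (m + 1) → (Fin n → ℤ) → (Fin n → ℤ) → Prop := fun j =>
    Relation.ReflTransGen (ChainStep 3 (A j))
  let C : Fin n → Set (Fin n → ℤ) := fun i => {x | x i ≤ 0 ∨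
    ∃ h : i.val < m + 1, x ∈ A ⟨i, h⟩ ∧ ∃ y ∈ A ⟨i, h⟩, y i ≤ 2 ∧ R ⟨i, h⟩ y x}
  have hcoord : ∀ (x y : Fin n → ℤ) (i : Fin n) (c : ℝ), dist x y ≤ c → ((x i - y i : ℤ) : ℝ) ≤ c := by
    intro x y i c h
    have h1 := (dist_le_pi_dist x y i).trans h
    rw [Int.dist_eq] at h1
    push_cast
    exact (le_abs_self _).trans h1
  have hC : ∀ (i : Fin n) (h : i.val < m + 1) (c w : Fin n → ℤ), c ∈ C i → w ∈ A ⟨i, h⟩ →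
      dist w c ≤ 2 → w ∈ C i := by
    rintro i h c w (hc | ⟨_, hcA, y, hyA, hy, hyc⟩) hw hd
    · have h2 : w i - c i ≤ 2 := by exact_mod_cast hcoord _ _ i _ hd
      exact .inr ⟨h, hw, w, hw, by omega, .refl⟩
    · exact .inr ⟨h, hw, y, hyA, hy, hyc.tail ⟨hcA, hw, by rw [dist_comm]; linarith⟩⟩
  have hcross : ∀ k : Fin n, Kuhn.Crosses (max ⌈b⌉ 0 + 4)
      (fun x => if ∃ c ∈ C k, dist x c ≤ 1 then 1 else 0) k := by
    intro k
    refine ⟨fun x hx => if_pos ⟨x, .inl hx, by simp⟩, fun x hx => if_neg ?_⟩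
    rintro ⟨c, hc, hxc⟩
    have h1 : x k - c k ≤ 1 := by exact_mod_cast hcoord _ _ k _ hxc
    rcases hc with hc | ⟨h, _, y, _, hy, hyc⟩
    · omega
    · have h2 : ((c k - y k : ℤ) : ℝ) ≤ ⌈b⌉ := by
        refine (hcoord _ _ k _ ?_).trans (Int.le_ceil b)
        rw [dist_comm]
        exact hA _ _ _ hyc
      have h3 : c k - y k ≤ ⌈b⌉ := by exact_mod_cast h2
      omega
  obtain ⟨x, hx⟩ := Kuhn.exists_cube (by omega) hcross
  have hclose : ∀ u : Fin n → ℤ, (∀ i, x i ≤ u i ∧ u i ≤ x i + 1) → dist x u ≤ 1 := by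
    intro u hu
    refine (dist_pi_le_iff zero_le_one).2 fun i => ?_
    rw [Int.dist_eq, ← Int.cast_sub, ← Int.cast_abs]
    have : |x i - u i| ≤ 1 := abs_le.2 ⟨by linarith [hu i], by linarith [hu i]⟩
    exact_mod_cast this
  obtain ⟨j, hj⟩ := hcov x
  obtain ⟨u, v, hu, hv, hφu, hφv⟩ := hx ⟨j, by omega⟩
  obtain ⟨c, hc, huc⟩ : ∃ c ∈ C ⟨j, by omega⟩, dist u c ≤ 1 := by
    by_contra h
    rw [if_neg h] at hφu
    exact zero_ne_one hφu
  have hxC : x ∈ C ⟨j, by omega⟩ := hC _ j.2 c x hc hj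
    (by linarith [dist_triangle x u c, hclose u hu])
  rw [if_pos ⟨x, hxC, by rw [dist_comm]; exact hclose v hv⟩] at hφv
  exact one_ne_zero hφv

theorem theoremt (n : ℕ) :
    ∃ (M : Type) (_ : MetricSpace M),
      TopologicalSpace.SeparableSpace M ∧ AsdimEq M n ∧
      ∀ (X : Type*) [MetricSpace X] [ProperSpace X], AsdimLE X n →
        ∃ f : X → M, IsLargeScaleEmbedding f := by
  refine ⟨UniversalSpace n, inferInstance, inferInstance,
    ⟨UniversalSpace.asdimLE n, fun m hm h => ?_⟩, fun X _ _ h => h.exists_isLargeScaleEmbedding⟩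
  obtain ⟨f, hf⟩ := (asdimLE_int_pi n).exists_isLargeScaleEmbedding
  exact not_asdimLE_int_pi hm (h.of_isLargeScaleEmbedding hf)
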